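/- Let $n\ge 1$, $d=2n-1$, and let $\mathbb S^d(\mathbb C)=\{z\in\mathbb C^n:|z|=1\}$ carry the round metric and the rotation-invariant probability measure $\nu$; write $L_p=L_p(\mathbb S^d(\mathbb C),\nu)$ for the space of complex-valued functions with its usual norm $\|\cdot\|_p$. Let $\Delta$ be the (nonnegative) Laplace–Beltrami operator, and for $k\ge 0$ let $\mathrm H_k=\{u\in C^\infty(\mathbb S^d(\mathbb C)):\Delta u=\theta_k u\}$ be its eigenspace for the eigenvalue $\theta_k=k(k+d-1)$. For $N\ge 1$ put $\mathcal T_N=\mathrm{lin}\{\mathrm H_k\}_{k=1}^N$ and $\mathcal T_N^0=\mathrm{lin}\{\mathrm H_k\}_{k=0}^N=\mathrm H_0\oplus\mathcal T_N$, where $\mathrm H_0$ is the space of constants. For a linear space $\mathcal T$ of functions put $E(f,\mathcal T,L_p)=\inf_{t\in\mathcal T}\|f-t\|_p$. For $\gamma>0$ and $f\in L_p$, a function $f^{(\gamma)}\in L_p$ is called the $\gamma$-th fractional derivative of $f$ if $\int f^{(\gamma)}\,d\nu=0$ and $$\int f^{(\gamma)}\,\overline{Y}\,d\nu=\theta_k^{\gamma/2}\int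 f\,\overline{Y}\,d\nu\qquad\text{for all }k\ge1,\ Y\in \mathrm H_k .$$ **Theorem.** Let $\gamma>(d-1)/2$. There is a constant $C>0$, depending only on $d$ and $\gamma$, such that for all $1\le p\le\infty$, all $f\in L_p$ that have a fractional derivative $f^{(\gamma)}\in L_p$, and all integers $N\ge1$: 1. if $\int f\,d\nu=0$, then $$E(f,\mathcal T_N,L_p)\le C\,N^{-\gamma}\,E(f^{(\gamma)},\mathcal T_N,L_p);$$ 2. without any condition on the mean of $f$, $$E(f,\mathcal T_N^0,L_p)\le C\,N^{-\gamma}\,E(f^{(\gamma)},\mathcal T_N^0,L_p).$$ -/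

import Mathlib

open MeasureTheory Metric
open scoped ENNReal ContDiff Laplacian

namespace ComplexSphere

noncomputable section

/-- The unit sphere of `ℂⁿ` (Hermitian norm). Its real dimension is `d = 2n - 1`. -/
abbrev CSphere (n : ℕ) : Type := sphere (0 : EuclideanSpace ℂ (Fin n)) 1

/-- The real dimension `d = 2n - 1` of the sphere of `ℂⁿ` (used for `n ≥ 1` only). -/
def realDim (n : ℕ) : ℕ := 2 * n - 1

/-- The rotation invariant surface measure, normalized to total mass one. -/
def nu (n : ℕ) : Measure (CSphere n) :=
  ((volume : Measure (EuclideanSpace ℂ (Fin n))).toSphere Set.univ)⁻¹ •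
    (volume : Measure (EuclideanSpace ℂ (Fin n))).toSphere

open Classical in
/-- The extension of `u` to `ℂⁿ \ {0}` that is constant on rays, `y ↦ u (y / ‖y‖)`
(with value `0` at the origin). -/
def radialExt {n : ℕ} (u : CSphere n → ℂ) (y : EuclideanSpace ℂ (Fin n)) : ℂ :=
  if h : (‖y‖⁻¹ : ℝ) • y ∈ sphere (0 : EuclideanSpace ℂ (Fin n)) 1 then u ⟨(‖y‖⁻¹ : ℝ) • y, h⟩
  else 0

/-- `u` is a smooth function on the sphere: its radially constant extension is smooth
off the origin. -/
def IsSmooth {n : ℕ} (u : CSphere n → ℂ) : Prop :=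
  ContDiffOn ℝ ∞ (radialExt u) {0}ᶜ

/-- The (nonnegative) Laplace-Beltrami operator of the round unit sphere: minus the Euclidean
Laplacian on `ℂⁿ = ℝ²ⁿ` of the radially constant extension, restricted to the sphere. -/
def laplaceBeltrami {n : ℕ} (u : CSphere n → ℂ) (x : CSphere n) : ℂ :=
  -(Δ (radialExt u)) (x : EuclideanSpace ℂ (Fin n))

/-- The eigenvalue `θ_k = k (k + d - 1)`. -/
def theta (n k : ℕ) : ℝ := k * (k + (realDim n : ℝ) - 1)

theorem radialExt_add {n : ℕ} (u v : CSphere n → ℂ) :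
    radialExt (u + v) = radialExt u + radialExt v := by
  funext y
  by_cases h : (‖y‖⁻¹ : ℝ) • y ∈ sphere (0 : EuclideanSpace ℂ (Fin n)) 1
  · simp only [radialExt, dif_pos h, Pi.add_apply]
  · simp only [radialExt, dif_neg h, Pi.add_apply, add_zero]

theorem radialExt_smul {n : ℕ} (c : ℂ) (u : CSphere n → ℂ) :
    radialExt (c • u) = c • radialExt u := by
  funext y
  by_cases h : (‖y‖⁻¹ : ℝ) • y ∈ sphere (0 : EuclideanSpace ℂ (Fin n)) 1
  · simp only [radialExt, dif_pos h, Pi.smul_apply]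
  · simp only [radialExt, dif_neg h, Pi.smul_apply, smul_zero]

theorem IsSmooth.contDiffAt {n : ℕ} {u : CSphere n → ℂ} (hu : IsSmooth u) (x : CSphere n) :
    ContDiffAt ℝ 2 (radialExt u) (x : EuclideanSpace ℂ (Fin n)) := by
  have hx : (x : EuclideanSpace ℂ (Fin n)) ≠ 0 := by
    intro h
    have := x.2
    simp [h] at this
  have h := ContDiffOn.contDiffAt hu (isOpen_compl_singleton.mem_nhds hx)
  exact h.of_le (WithTop.coe_le_coe.2 (le_top : (2 : ℕ∞) ≤ ⊤))

/-- The eigenspace `H_k` of the Laplace-Beltrami operator for the eigenvalue `θ_k`. -/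
def eigenspace (n k : ℕ) : Submodule ℂ (CSphere n → ℂ) where
  carrier := {u | IsSmooth u ∧ ∀ x, laplaceBeltrami u x = (theta n k : ℂ) * u x}
  zero_mem' := by
    have h0 : radialExt (0 : CSphere n → ℂ) = fun _ => 0 := by
      funext y
      simp [radialExt]
    refine ⟨?_, fun x => ?_⟩
    · simp only [IsSmooth, h0]
      exact contDiffOn_const
    · have : radialExt (0 : CSphere n → ℂ) = (0 : ℝ) • radialExt (0 : CSphere n → ℂ) := by
        rw [h0]; funext y; simp
      simp only [laplaceBeltrami, Pi.zero_apply, mul_zero, neg_eq_zero]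
      rw [this, InnerProductSpace.laplacian_smul]
      · simp
      · rw [h0]; exact contDiffAt_const
  add_mem' := by
    rintro u v ⟨hu, hu'⟩ ⟨hv, hv'⟩
    refine ⟨?_, fun x => ?_⟩
    · simp only [IsSmooth, radialExt_add]
      exact ContDiffOn.add hu hv
    · have h1 := hu' x
      have h2 := hv' x
      simp only [laplaceBeltrami] at h1 h2 ⊢
      rw [radialExt_add, (hu.contDiffAt x).laplacian_add (hv.contDiffAt x)]
      simp only [Pi.add_apply]
      rw [mul_add, ← h1, ← h2]
      ring
  smul_mem' := by
    rintro c u ⟨hu, hu'⟩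
    refine ⟨?_, fun x => ?_⟩
    · simp only [IsSmooth, radialExt_smul]
      exact ContDiffOn.const_smul c hu
    · have h1 := hu' x
      simp only [laplaceBeltrami] at h1 ⊢
      have h2 : c • radialExt u = ⇑(c • ContinuousLinearMap.id ℝ ℂ) ∘ radialExt u := by
        funext y; simp
      rw [radialExt_smul, h2, (hu.contDiffAt x).laplacian_CLM_comp_left]
      simp only [Function.comp_apply, _root_.smul_apply, ContinuousLinearMap.id_apply,
        Pi.smul_apply, smul_eq_mul]
      rw [mul_left_comm, ← h1]
      ring

/-- The linear span of the eigenspaces `H_k`, `k ∈ K`. -/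
def harmonicSpan (n : ℕ) (K : Finset ℕ) : Submodule ℂ (CSphere n → ℂ) :=
  ⨆ k ∈ K, eigenspace n k

/-- `T_N = lin {H_1, …, H_N}`. -/
def polySpace (n N : ℕ) : Submodule ℂ (CSphere n → ℂ) := harmonicSpan n (Finset.Icc 1 N)

/-- `H_0 + T_N = lin {H_0, H_1, …, H_N}`. -/
def polySpaceConst (n N : ℕ) : Submodule ℂ (CSphere n → ℂ) := harmonicSpan n (Finset.Icc 0 N)

/-- The best approximation `E(f, T, L_p) = inf {‖f - t‖_p : t ∈ T}`. -/
def bestApprox {n : ℕ} (f : CSphere n → ℂ) (T : Submodule ℂ (CSphere n → ℂ)) (p : ℝ≥0∞) : ℝ≥0∞ :=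
  ⨅ t ∈ T, eLpNorm (f - t) p (nu n)

/-- The Fourier coefficient `∫ f · conj Y dν` of `f` with respect to `Y`. -/
def fourierCoeff {n : ℕ} (f Y : CSphere n → ℂ) : ℂ :=
  ∫ x, f x * (starRingEnd ℂ) (Y x) ∂(nu n)

/-- `g` is a `γ`-th fractional derivative of `f`: the formal Fourier series of `g` is
`∑_{k ≥ 1} θ_k^{γ/2} ∑_m c_{k,m}(f) Y_m^k`. The coefficients are compared against every element
of each eigenspace, which is the same as comparing them on an orthonormal basis of it. -/
def IsFracDeriv {n : ℕ} (γ : ℝ) (f g : CSphere n → ℂ) : Prop :=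
  (∀ Y ∈ eigenspace n 0, fourierCoeff g Y = 0) ∧
  ∀ k : ℕ, 1 ≤ k → ∀ Y ∈ eigenspace n k,
    fourierCoeff g Y = ((theta n k ^ (γ / 2) : ℝ) : ℂ) * fourierCoeff f Y

end

end ComplexSphere

/-! The zonal harmonics of the sphere are the coefficients in `r` of the Poisson kernel
`(1 - r²) / (1 - 2 r t + r²) ^ n`, and multiplying it by `(1 - r) ^ (-2 n)` gives the Cesàro kernels
of order `d = 2 n - 1`. The product is a power of the generating series of the Fejér kernels times a
power of `1 / (1 - r²)`, so these kernels are nonnegative, and convolution with one of them acts on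
every `L_p` with norm at most its mass, a Cesàro number. As `k ↦ θ_k ^ (-γ / 2)` is completely
monotone, summation by parts `d + 1` times writes it, for `k > N`, as a nonnegative combination of
the multipliers of the Cesàro kernels whose total mass is at most a constant times `N ^ (-γ)`.
Applied to `g - t`, where `g` is the fractional derivative of `f` and `t` a polynomial of degree at
most `N`, this combination of kernels gives a function that agrees with `f` up to a polynomial of
degree at most `N`. -/

namespace ComplexSphere

noncomputable section

section Zonal

open Polynomial
open scoped PowerSeries

theorem derivation_pow_of_mul_eq_one {R A : Type*} [CommRing R] [CommRing A] [Algebra R A]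
    (D : Derivation R A A) {a b : A} (h : a * b = 1) (m : ℕ) :
    D (a ^ m) = -(m * a ^ (m + 1) * D b) := by
  cases m with
  | zero => simp
  | succ m =>
    rw [D.leibniz_pow, D.leibniz_of_mul_eq_one h, Nat.add_sub_cancel]
    simp only [nsmul_eq_mul, smul_eq_mul]
    ring

/-- The derivation of power series in `r` over `ℝ[t]` that differentiates each coefficient with
respect to `t`. -/
def parameterDerivation : Derivation ℝ ℝ[X]⟦X⟧ ℝ[X]⟦X⟧ :=
  Derivation.mk'
    { toFun := fun f => PowerSeries.mk fun j => derivative (PowerSeries.coeff j f)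
      map_add' := fun f g => by ext1 j; simp
      map_smul' := fun c f => by ext1 j; simp }
    fun f g => by
      ext1 j
      have hswap : g * PowerSeries.mk (fun j => derivative (PowerSeries.coeff j f)) =
          PowerSeries.mk (fun j => derivative (PowerSeries.coeff j f)) * g := mul_comm _ _
      simp [hswap, PowerSeries.coeff_mul, Finset.sum_add_distrib, add_comm]

theorem coeff_parameterDerivation (f : ℝ[X]⟦X⟧) (j : ℕ) :
    PowerSeries.coeff j (parameterDerivation f) = derivative (PowerSeries.coeff j f) := by
  simp [parameterDerivation]

theorem parameterDerivation_C (p : ℝ[X]) :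
    parameterDerivation (PowerSeries.C p) = PowerSeries.C (derivative p) := by
  ext1 j
  rw [coeff_parameterDerivation, PowerSeries.coeff_C, PowerSeries.coeff_C]
  split_ifs <;> simp

theorem parameterDerivation_X : parameterDerivation PowerSeries.X = 0 := by
  ext1 j
  rw [coeff_parameterDerivation, PowerSeries.coeff_X]
  split_ifs <;> simp

/-- The Euler operator `r d/dr` on power series in `r` over `ℝ[t]`. -/
def eulerDerivation : Derivation ℝ ℝ[X]⟦X⟧ ℝ[X]⟦X⟧ :=
  Derivation.mk'
    { toFun := fun f => PowerSeries.X * PowerSeries.derivative ℝ[X] f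
      map_add' := fun f g => by rw [map_add, mul_add]
      map_smul' := fun c f => by
        ext1 j
        cases j <;> simp [PowerSeries.coeff_succ_X_mul, PowerSeries.coeff_derivative] }
    fun f g => by
      simp only [LinearMap.coe_mk, AddHom.coe_mk, Derivation.leibniz, smul_eq_mul]
      ring

theorem coeff_eulerDerivation (f : ℝ[X]⟦X⟧) (j : ℕ) :
    PowerSeries.coeff j (eulerDerivation f) = j * PowerSeries.coeff j f := by
  cases j with
  | zero => simp [eulerDerivation]
  | succ j =>
    simp [eulerDerivation, PowerSeries.coeff_succ_X_mul, PowerSeries.coeff_derivative, mul_comm]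

theorem eulerDerivation_C (p : ℝ[X]) : eulerDerivation (PowerSeries.C p) = 0 := by
  ext1 j
  rw [coeff_eulerDerivation, PowerSeries.coeff_C]
  split_ifs with h <;> simp [h]

theorem eulerDerivation_X : eulerDerivation PowerSeries.X = PowerSeries.X := by
  simp [eulerDerivation]

/-- The polynomial `1 - 2 r t + r²`, as a power series in `r` over `ℝ[t]`. -/
def poissonDenom : ℝ[X]⟦X⟧ :=
  1 - PowerSeries.C (2 * X) * PowerSeries.X + PowerSeries.X ^ 2

/-- The inverse of `1 - 2 r t + r²`, as a power series in `r` over `ℝ[t]`. -/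
def poissonDenomInv : ℝ[X]⟦X⟧ := PowerSeries.invOfUnit poissonDenom 1

/-- The Poisson kernel `(1 - r²) / (1 - 2 r t + r²) ^ n` of the unit ball of `ℝ²ⁿ`, as a power
series in `r` over `ℝ[t]`; `t` stands for the inner product of two unit vectors. -/
def poissonKernel (n : ℕ) : ℝ[X]⟦X⟧ :=
  (1 - PowerSeries.X ^ 2) * poissonDenomInv ^ n

/-- The zonal harmonic of degree `j` on the unit sphere of `ℝ²ⁿ`, as a polynomial in the inner
product `t` with the pole. -/
def zonal (n j : ℕ) : ℝ[X] := PowerSeries.coeff j (poissonKernel n)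

theorem poissonDenomInv_mul_poissonDenom : poissonDenomInv * poissonDenom = 1 := by
  rw [mul_comm]
  exact PowerSeries.mul_invOfUnit _ _ (by simp [poissonDenom])

theorem constantCoeff_poissonDenomInv : PowerSeries.constantCoeff poissonDenomInv = 1 := by
  simp [poissonDenomInv]

theorem parameterDerivation_poissonDenom :
    parameterDerivation poissonDenom = -2 * PowerSeries.X := by
  have h : derivative (2 * X : ℝ[X]) = 2 := by simp
  simp only [poissonDenom, map_add, map_sub, Derivation.leibniz, Derivation.leibniz_pow,
    Derivation.map_one_eq_zero, parameterDerivation_C, parameterDerivation_X, smul_eq_mul, h,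
    map_ofNat]
  ring

theorem eulerDerivation_poissonDenom :
    eulerDerivation poissonDenom =
      2 * PowerSeries.X ^ 2 - 2 * PowerSeries.C X * PowerSeries.X := by
  simp only [poissonDenom, map_add, map_sub, Derivation.leibniz, Derivation.leibniz_pow,
    Derivation.map_one_eq_zero, eulerDerivation_C, eulerDerivation_X, smul_eq_mul, map_mul,
    map_ofNat, show eulerDerivation 2 = 0 from eulerDerivation.map_natCast 2]
  norm_num
  ring

theorem poissonKernel_pde (n : ℕ) :
    (1 - PowerSeries.C X ^ 2) * parameterDerivation (parameterDerivation (poissonKernel n)) -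
      (2 * (n : ℝ[X]⟦X⟧) - 1) * PowerSeries.C X * parameterDerivation (poissonKernel n) +
      eulerDerivation (eulerDerivation (poissonKernel n)) +
      (2 * (n : ℝ[X]⟦X⟧) - 2) * eulerDerivation (poissonKernel n) = 0 := by
  have h2 (D : Derivation ℝ ℝ[X]⟦X⟧ ℝ[X]⟦X⟧) : D 2 = 0 := D.map_natCast 2
  have hT (m : ℕ) := derivation_pow_of_mul_eq_one parameterDerivation
    poissonDenomInv_mul_poissonDenom m
  have hE (m : ℕ) := derivation_pow_of_mul_eq_one eulerDerivation
    poissonDenomInv_mul_poissonDenom m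
  have hQ := poissonDenomInv_mul_poissonDenom
  simp only [poissonDenom, map_mul, map_ofNat] at hQ
  simp only [poissonKernel, Derivation.leibniz, Derivation.leibniz_pow, map_add, map_sub, map_neg,
    map_zero, hT, hE, h2, parameterDerivation_poissonDenom, eulerDerivation_poissonDenom,
    parameterDerivation_X, eulerDerivation_X, eulerDerivation_C, Derivation.map_one_eq_zero,
    Derivation.map_natCast, smul_eq_mul, nsmul_eq_mul]
  norm_num
  linear_combination 4 * (n : ℝ[X]⟦X⟧) * PowerSeries.X ^ 2 * poissonDenomInv ^ n *
    (1 + (n + 1) * (1 - PowerSeries.X ^ 2) * poissonDenomInv) * hQ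

theorem zonal_gegenbauer_ode (n j : ℕ) :
    (1 - X ^ 2) * derivative (derivative (zonal n j)) -
      (2 * (n : ℝ[X]) - 1) * X * derivative (zonal n j) +
      (j : ℝ[X]) * ((j : ℝ[X]) + (2 * (n : ℝ[X]) - 2)) * zonal n j = 0 := by
  have h := congrArg (PowerSeries.coeff j) (poissonKernel_pde n)
  have hC1 : (1 - PowerSeries.C X ^ 2 : ℝ[X]⟦X⟧) = PowerSeries.C (1 - X ^ 2) := by simp
  have hC2 : ((2 * (n : ℝ[X]⟦X⟧) - 1) * PowerSeries.C X) =
      PowerSeries.C ((2 * (n : ℝ[X]) - 1) * X) := by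
    simp only [map_mul, map_sub, map_one, map_ofNat, map_natCast]
  have hC3 : (2 * (n : ℝ[X]⟦X⟧) - 2) = PowerSeries.C (2 * (n : ℝ[X]) - 2) := by
    simp only [map_mul, map_sub, map_ofNat, map_natCast]
  rw [hC1, hC2, hC3] at h
  simp only [map_add, LinearMap.map_sub, map_zero, PowerSeries.coeff_C_mul,
    coeff_parameterDerivation, coeff_eulerDerivation] at h
  rw [zonal]
  linear_combination h

theorem poissonKernel_eq_succ (n : ℕ) :
    poissonKernel n = poissonKernel (n + 1) * poissonDenom := by
  rw [poissonKernel, poissonKernel, mul_assoc, pow_succ poissonDenomInv, mul_assoc,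
    poissonDenomInv_mul_poissonDenom, mul_one]

theorem coeff_one_mul_poissonDenom (f : ℝ[X]⟦X⟧) :
    PowerSeries.coeff 1 (f * poissonDenom) =
      PowerSeries.coeff 1 f - 2 * X * PowerSeries.coeff 0 f := by
  have hexp : f * poissonDenom =
      f - PowerSeries.C (2 * X) * (f * PowerSeries.X) + f * PowerSeries.X * PowerSeries.X := by
    rw [poissonDenom]; ring
  have hshift (g : ℝ[X]⟦X⟧) : PowerSeries.coeff 1 (g * PowerSeries.X) = PowerSeries.coeff 0 g :=
    PowerSeries.coeff_succ_mul_X 0 g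
  simp only [hexp, map_add, map_sub, PowerSeries.coeff_C_mul, hshift,
    PowerSeries.coeff_zero_mul_X, add_zero]

theorem coeff_add_two_mul_poissonDenom (f : ℝ[X]⟦X⟧) (j : ℕ) :
    PowerSeries.coeff (j + 2) (f * poissonDenom) =
      PowerSeries.coeff (j + 2) f - 2 * X * PowerSeries.coeff (j + 1) f +
        PowerSeries.coeff j f := by
  have hexp : f * poissonDenom =
      f - PowerSeries.C (2 * X) * (f * PowerSeries.X) + f * PowerSeries.X * PowerSeries.X := by
    rw [poissonDenom]; ring
  simp only [hexp, map_add, map_sub, PowerSeries.coeff_C_mul, PowerSeries.coeff_succ_mul_X]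

theorem zonal_zero (n : ℕ) : zonal n 0 = 1 := by
  simp [zonal, poissonKernel, constantCoeff_poissonDenomInv]

theorem zonal_one (n : ℕ) : zonal n 1 = 2 * (n : ℝ[X]) * X := by
  induction n with
  | zero => simp [zonal, poissonKernel, PowerSeries.coeff_one, PowerSeries.coeff_X_pow]
  | succ n ih =>
    have h := coeff_one_mul_poissonDenom (poissonKernel (n + 1))
    rw [← poissonKernel_eq_succ, ← zonal, ← zonal, ← zonal, ih, zonal_zero] at h
    push_cast
    linear_combination -h

theorem zonal_two (n : ℕ) :
    zonal n 2 = ((n : ℝ[X]) + 1) * (2 * (n : ℝ[X]) * X ^ 2 - 1) := by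
  induction n with
  | zero => simp [zonal, poissonKernel, PowerSeries.coeff_one, PowerSeries.coeff_X_pow]
  | succ n ih =>
    have h := coeff_add_two_mul_poissonDenom (poissonKernel (n + 1)) 0
    rw [← poissonKernel_eq_succ, zero_add, zero_add, ← zonal, ← zonal, ← zonal, ← zonal, ih,
      zonal_zero, zonal_one] at h
    push_cast at h ⊢
    linear_combination -h

/-- The Cesàro number `A_k^d`, the coefficient of `r ^ k` in `(1 - r) ^ (-(d + 1))`. -/
def cesaroNumber (d k : ℕ) : ℕ := (d + k).choose d

theorem cesaroNumber_pos (d k : ℕ) : 0 < cesaroNumber d k := Nat.choose_pos (Nat.le_add_right d k)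

/-- The Cesàro kernel of order `2 n - 1` and degree `M` on the unit sphere of `ℝ²ⁿ`, not
normalized: its mass is the Cesàro number of `M`. -/
def cesaroKernel (n M : ℕ) : ℝ[X] :=
  ∑ j ∈ Finset.range (M + 1), (cesaroNumber (realDim n) (M - j) : ℝ[X]) * zonal n j

theorem cesaroKernel_eq_coeff (n M : ℕ) (hn : n ≠ 0) :
    cesaroKernel n M = PowerSeries.coeff M (poissonKernel n * PowerSeries.mk 1 ^ (2 * n)) := by
  rw [show 2 * n = realDim n + 1 by rw [realDim]; lia, PowerSeries.mk_one_pow_eq_mk_choose_add,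
    PowerSeries.coeff_mul, Finset.Nat.sum_antidiagonal_eq_sum_range_succ_mk]
  refine Finset.sum_congr rfl fun j _ => ?_
  rw [PowerSeries.coeff_mk, mul_comm, cesaroNumber, zonal]

/-- The generating series `(1 + r) / ((1 - r) (1 - 2 r t + r²))` of the Fejér kernels. -/
def fejerSeries : ℝ[X]⟦X⟧ :=
  (1 + PowerSeries.X) * PowerSeries.mk 1 * poissonDenomInv

theorem fejerSeries_mul_poissonDenom :
    fejerSeries * poissonDenom = (1 + PowerSeries.X) * PowerSeries.mk 1 := by
  rw [fejerSeries, mul_assoc, poissonDenomInv_mul_poissonDenom, mul_one]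

theorem coeff_zero_fejerSeries : PowerSeries.coeff 0 fejerSeries = 1 := by
  simp [fejerSeries, constantCoeff_poissonDenomInv]

theorem coeff_one_fejerSeries : PowerSeries.coeff 1 fejerSeries = 2 + 2 * X := by
  have h := coeff_one_mul_poissonDenom fejerSeries
  rw [fejerSeries_mul_poissonDenom, coeff_zero_fejerSeries, add_mul, one_mul] at h
  have hshift : PowerSeries.coeff 1 (PowerSeries.X * PowerSeries.mk 1 : ℝ[X]⟦X⟧) = 1 :=
    PowerSeries.coeff_succ_X_mul 0 _
  simp only [map_add, PowerSeries.coeff_mk, Pi.one_apply, hshift] at h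
  linear_combination -h

theorem coeff_add_two_fejerSeries (N : ℕ) :
    PowerSeries.coeff (N + 2) fejerSeries = 2 * X * PowerSeries.coeff (N + 1) fejerSeries -
      PowerSeries.coeff N fejerSeries + 2 := by
  have h := coeff_add_two_mul_poissonDenom fejerSeries N
  rw [fejerSeries_mul_poissonDenom, add_mul, one_mul] at h
  simp only [map_add, PowerSeries.coeff_mk, PowerSeries.coeff_succ_X_mul, Pi.one_apply] at h
  linear_combination -h

theorem one_sub_X_mul_coeff_fejerSeries (N : ℕ) :
    (1 - X) * PowerSeries.coeff N fejerSeries = 1 - Chebyshev.T ℝ (N + 1) := by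
  induction N using Nat.twoStepInduction with
  | zero => simp [coeff_zero_fejerSeries]
  | one =>
    rw [coeff_one_fejerSeries, Nat.cast_one, one_add_one_eq_two, Chebyshev.T_two]
    ring
  | more N h0 h1 =>
    have hT := Chebyshev.T_add_two ℝ (N + 1)
    push_cast at h0 h1 ⊢
    rw [show (N : ℤ) + 2 + 1 = N + 1 + 2 by ring, hT, coeff_add_two_fejerSeries]
    linear_combination 2 * X * h1 - h0

theorem eval_one_coeff_fejerSeries (N : ℕ) :
    (PowerSeries.coeff N fejerSeries).eval 1 = ((N : ℝ) + 1) ^ 2 := by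
  induction N using Nat.twoStepInduction with
  | zero => simp [coeff_zero_fejerSeries]
  | one => norm_num [coeff_one_fejerSeries]
  | more N h0 h1 =>
    rw [coeff_add_two_fejerSeries]
    simp only [eval_add, eval_sub, eval_mul, eval_ofNat, eval_X, h0, h1]
    push_cast
    ring

theorem eval_coeff_fejerSeries_nonneg {t : ℝ} (ht : |t| ≤ 1) (N : ℕ) :
    0 ≤ (PowerSeries.coeff N fejerSeries).eval t := by
  obtain rfl | hlt := (abs_le.1 ht).2.eq_or_lt
  · rw [eval_one_coeff_fejerSeries]
    positivity
  · have hmul := congrArg (eval t) (one_sub_X_mul_coeff_fejerSeries N)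
    simp only [eval_mul, eval_sub, eval_one, eval_X] at hmul
    have hT := (abs_le.1 (Chebyshev.abs_eval_T_real_le_one (N + 1) ht)).2
    exact nonneg_of_mul_nonneg_right (by linarith) (sub_pos.2 hlt)

/-- The power series over `R[t]` whose coefficients are nonnegative at the point `t`. -/
def coeffNonneg {R : Type*} [CommRing R] [LinearOrder R] [IsStrictOrderedRing R] (t : R) :
    Subsemiring R[X]⟦X⟧ where
  carrier := {f | ∀ j, 0 ≤ (PowerSeries.coeff j f).eval t}
  zero_mem' := fun j => by simp
  add_mem' := fun hf hg j => by
    rw [map_add, eval_add]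
    exact add_nonneg (hf j) (hg j)
  one_mem' := fun j => by
    rw [PowerSeries.coeff_one]
    split_ifs <;> simp
  mul_mem' := fun hf hg j => by
    rw [PowerSeries.coeff_mul, eval_finsetSum]
    exact Finset.sum_nonneg fun p _ => by
      rw [eval_mul]
      exact mul_nonneg (hf _) (hg _)

theorem one_sub_X_sq_mul_mk_even {R : Type*} [CommRing R] :
    (1 - PowerSeries.X ^ 2 : R⟦X⟧) * PowerSeries.mk (fun j => if Even j then 1 else 0) = 1 := by
  ext j
  rw [sub_mul, one_mul, map_sub]
  match j with
  | 0 => simp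
  | 1 => simp [PowerSeries.coeff_X_pow_mul', PowerSeries.coeff_one]
  | j + 2 => simp [PowerSeries.coeff_X_pow_mul', PowerSeries.coeff_one, Nat.even_add]

/-- Both factors on the right have nonnegative coefficients at every `|t| ≤ 1`, whence the
positivity of the Cesàro kernels. -/
theorem poissonKernel_mul_mk_one_pow (m : ℕ) :
    poissonKernel (m + 1) * PowerSeries.mk 1 ^ (2 * (m + 1)) =
      fejerSeries ^ (m + 1) * PowerSeries.mk (fun j => if Even j then 1 else 0) ^ m := by
  have hgeom : PowerSeries.mk 1 * (1 - PowerSeries.X : ℝ[X]⟦X⟧) = 1 :=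
    PowerSeries.mk_one_mul_one_sub_eq_one _
  have heven := one_sub_X_sq_mul_mk_even (R := ℝ[X])
  have hfejer : fejerSeries =
      (1 - PowerSeries.X ^ 2) * (PowerSeries.mk 1 ^ 2 * poissonDenomInv) := by
    rw [fejerSeries]
    linear_combination -(1 + PowerSeries.X) * PowerSeries.mk 1 * poissonDenomInv * hgeom
  rw [poissonKernel, hfejer, mul_pow, pow_succ (1 - PowerSeries.X ^ 2 : ℝ[X]⟦X⟧) m]
  have hcancel := congrArg (· ^ m) heven
  simp only [mul_pow, one_pow] at hcancel
  linear_combination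
    -(1 - PowerSeries.X ^ 2) * (PowerSeries.mk 1 ^ 2 * poissonDenomInv) ^ (m + 1) * hcancel

theorem eval_cesaroKernel_nonneg {n : ℕ} (hn : n ≠ 0) (M : ℕ) {t : ℝ} (ht : |t| ≤ 1) :
    0 ≤ (cesaroKernel n M).eval t := by
  obtain ⟨m, rfl⟩ := Nat.exists_eq_succ_of_ne_zero hn
  have hfejer : fejerSeries ∈ coeffNonneg t := eval_coeff_fejerSeries_nonneg ht
  have heven : PowerSeries.mk (fun j => if Even j then 1 else 0) ∈ coeffNonneg t := fun j => by
    rw [PowerSeries.coeff_mk]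
    split_ifs <;> simp
  rw [cesaroKernel_eq_coeff _ M hn, poissonKernel_mul_mk_one_pow]
  exact mul_mem (pow_mem hfejer _) (pow_mem heven _) M

end Zonal

section CompletelyMonotone

open Filter Topology

/-- The backward difference operator `h ↦ h k - h (k + 1)`, with the sign that keeps the iterated
differences of decreasing sequences such as `k ↦ k⁻ᵃ` nonnegative. -/
def decrement : Module.End ℝ (ℕ → ℝ) where
  toFun h k := h k - h (k + 1)
  map_add' f g := by ext k; simp only [Pi.add_apply]; ring
  map_smul' c f := by ext k; simp only [Pi.smul_apply, smul_eq_mul, RingHom.id_apply]; ring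

/-- A completely monotone sequence in the sense of Hausdorff. -/
def CompletelyMonotone (h : ℕ → ℝ) : Prop := ∀ m k, 0 ≤ (decrement ^ m) h k

theorem decrement_apply (h : ℕ → ℝ) (k : ℕ) : decrement h k = h k - h (k + 1) := rfl

theorem decrement_mul (f g : ℕ → ℝ) :
    decrement (f * g) = decrement f * g + (fun k => f (k + 1)) * decrement g := by
  ext k
  simp only [decrement_apply, Pi.mul_apply, Pi.add_apply]
  ring

theorem decrement_pow_succ (m : ℕ) (h : ℕ → ℝ) :
    (decrement ^ (m + 1)) h = (decrement ^ m) (decrement h) := by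
  rw [pow_succ, Module.End.mul_apply]

theorem decrement_pow_comp_add (m : ℕ) (h : ℕ → ℝ) (l k : ℕ) :
    (decrement ^ m) (fun i => h (l + i)) k = (decrement ^ m) h (l + k) := by
  induction m generalizing h with
  | zero => rfl
  | succ m ih => rw [decrement_pow_succ, decrement_pow_succ, ← ih]; rfl

variable {f g h : ℕ → ℝ}

theorem CompletelyMonotone.nonneg (hh : CompletelyMonotone h) (k : ℕ) : 0 ≤ h k := hh 0 k

protected theorem CompletelyMonotone.decrement (hh : CompletelyMonotone h) :
    CompletelyMonotone (decrement h) := fun m k => by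
  rw [← decrement_pow_succ]
  exact hh (m + 1) k

theorem CompletelyMonotone.comp_add (hh : CompletelyMonotone h) (l : ℕ) :
    CompletelyMonotone fun i => h (l + i) := fun m k => by
  rw [decrement_pow_comp_add]
  exact hh m (l + k)

theorem CompletelyMonotone.mul (hf : CompletelyMonotone f) (hg : CompletelyMonotone g) :
    CompletelyMonotone (f * g) := by
  intro m
  induction m generalizing f g with
  | zero => exact fun k => mul_nonneg (hf.nonneg k) (hg.nonneg k)
  | succ m ih =>
    intro k
    have hf' : CompletelyMonotone fun k => f (k + 1) := by
      simpa only [add_comm 1] using hf.comp_add 1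
    rw [decrement_pow_succ, decrement_mul, map_add]
    exact add_nonneg (ih hf.decrement hg k) (ih hf' hg.decrement k)

theorem CompletelyMonotone.hasSum_decrement (hh : CompletelyMonotone h)
    (h0 : Tendsto h atTop (𝓝 0)) (k : ℕ) : HasSum (fun i => decrement h (k + i)) (h k) := by
  rw [hasSum_iff_tendsto_nat_of_nonneg fun i => hh.decrement.nonneg (k + i)]
  have hsum (N : ℕ) : ∑ i ∈ Finset.range N, decrement h (k + i) = h k - h (k + N) :=
    Finset.sum_range_sub' (fun i => h (k + i)) N
  simp only [hsum]
  simpa only [sub_zero, add_comm k] using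
    tendsto_const_nhds.sub ((tendsto_add_atTop_iff_nat k).2 h0)

theorem tendsto_decrement (h0 : Tendsto h atTop (𝓝 0)) :
    Tendsto (decrement h) atTop (𝓝 0) :=
  (sub_zero (0 : ℝ)) ▸ h0.sub ((tendsto_add_atTop_iff_nat 1).2 h0)

theorem hasSum_sum_antidiagonal {F : ℕ × ℕ → ℝ} {s : ℝ} (hF : HasSum F s) :
    HasSum (fun l => ∑ p ∈ Finset.HasAntidiagonal.antidiagonal l, F p) s := by
  simp only [← Finset.sum_coe_sort _ F]
  exact (Finset.HasAntidiagonal.sigmaAntidiagonalEquivProd.hasSum_iff.2 hF).sigma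
    fun l => hasSum_fintype _

theorem hasSum_sum_range_mul {c e g : ℕ → ℝ} {s : ℝ} (hc : 0 ≤ c) (he : 0 ≤ e)
    (hg : ∀ j, HasSum (fun i => c i * e (j + i)) (g j)) (hs : HasSum g s) :
    HasSum (fun l => (∑ i ∈ Finset.range (l + 1), c i) * e l) s := by
  set F : ℕ × ℕ → ℝ := fun p => c p.2 * e (p.1 + p.2)
  have hF : Summable F := by
    rw [summable_prod_of_nonneg fun p => mul_nonneg (hc _) (he _)]
    exact ⟨fun j => (hg j).summable, hs.summable.congr fun j => (hg j).tsum_eq.symm⟩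
  have hFs : HasSum F s := by
    rw [hs.unique (hF.hasSum.prod_fiberwise hg)]
    exact hF.hasSum
  convert hasSum_sum_antidiagonal hFs using 2 with l
  rw [Finset.sum_mul, ← Finset.Nat.sum_antidiagonal_swap,
    Finset.Nat.sum_antidiagonal_eq_sum_range_succ_mk]
  refine Finset.sum_congr rfl fun i hi => ?_
  simp only [F, Prod.swap, Nat.sub_add_cancel (Finset.mem_range_succ_iff.1 hi)]

theorem sum_range_cesaroNumber (d l : ℕ) :
    ∑ i ∈ Finset.range (l + 1), cesaroNumber d i = cesaroNumber (d + 1) l := by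
  have h := Nat.sum_range_add_choose l d
  rwa [add_comm l d, add_right_comm, Finset.sum_congr rfl fun i _ => by rw [add_comm i d]] at h

theorem CompletelyMonotone.hasSum_cesaroNumber_mul (hh : CompletelyMonotone h)
    (h0 : Tendsto h atTop (𝓝 0)) (d k : ℕ) :
    HasSum (fun i => (cesaroNumber d i : ℝ) * (decrement ^ (d + 1)) h (k + i)) (h k) := by
  induction d generalizing h k with
  | zero => simpa [cesaroNumber] using hh.hasSum_decrement h0 k
  | succ d ih =>
    have hg (j : ℕ) := ih hh.decrement (tendsto_decrement h0) (k + j)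
    simp only [← decrement_pow_succ, add_assoc k] at hg
    simpa only [← Nat.cast_sum, sum_range_cesaroNumber] using
      hasSum_sum_range_mul (fun i => Nat.cast_nonneg _) (fun i => hh _ (k + i)) hg
        (hh.hasSum_decrement h0 k)

theorem hasSum_cesaroNumber_mul_of_comp_add {M k : ℕ}
    (hh : CompletelyMonotone fun i => h (M + i)) (h0 : Tendsto h atTop (𝓝 0)) (d : ℕ)
    (hk : M ≤ k) :
    HasSum (fun i => (cesaroNumber d i : ℝ) * (decrement ^ (d + 1)) h (k + i)) (h k) := by
  have hlim : Tendsto (fun i => h (M + i)) atTop (𝓝 0) := by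
    simpa only [add_comm M] using (tendsto_add_atTop_iff_nat M).2 h0
  simpa only [decrement_pow_comp_add, ← add_assoc, Nat.add_sub_cancel' hk] using
    hh.hasSum_cesaroNumber_mul hlim d (k - M)

theorem cesaroNumber_le_two_pow_mul (d : ℕ) {M k : ℕ} (hM : M ≤ k) :
    cesaroNumber d (M + k) ≤ 2 ^ d * cesaroNumber d k := by
  induction d with
  | zero => simp [cesaroNumber]
  | succ d ih =>
    simp only [cesaroNumber, add_right_comm d 1] at ih ⊢
    refine Nat.le_of_mul_le_mul_right ?_ d.succ_pos
    rw [← Nat.add_one_mul_choose_eq, mul_assoc, ← Nat.add_one_mul_choose_eq]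
    calc (d + (M + k) + 1) * (d + (M + k)).choose d
        ≤ (2 * (d + k + 1)) * (2 ^ d * (d + k).choose d) := Nat.mul_le_mul (by omega) ih
      _ = 2 ^ (d + 1) * ((d + k + 1) * (d + k).choose d) := by ring

theorem exists_cesaro_weights (d : ℕ) {φ : ℕ → ℝ} {M N : ℕ}
    (hφ : CompletelyMonotone fun i => φ (M + i)) (h0 : Tendsto φ atTop (𝓝 0))
    (hMN : 2 * M ≤ N + 1) :
    ∃ b : ℕ → ℝ, 0 ≤ b ∧ (Summable fun k => (cesaroNumber d k : ℝ) * b k) ∧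
      ∑' k, (cesaroNumber d k : ℝ) * b k ≤ 2 ^ d * φ M ∧
      ∀ j, N < j → HasSum (fun i => (cesaroNumber d i : ℝ) * b (j + i)) (φ j) := by
  set a : ℕ → ℝ := (decrement ^ (d + 1)) φ
  have ha0 (i : ℕ) : 0 ≤ a (M + i) :=
    (hφ _ i).trans_eq (decrement_pow_comp_add (d + 1) φ M i)
  have hsum : HasSum (fun i => (cesaroNumber d i : ℝ) * a (M + i)) (φ M) :=
    hasSum_cesaroNumber_mul_of_comp_add hφ h0 d le_rfl
  set b : ℕ → ℝ := fun k => if N < k then a k else 0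
  have hb_add (i : ℕ) : 0 ≤ b (M + i) ∧
      (cesaroNumber d (M + i) : ℝ) * b (M + i) ≤ 2 ^ d * (cesaroNumber d i * a (M + i)) := by
    by_cases hi : N < M + i
    · simp only [b, if_pos hi, ← mul_assoc]
      refine ⟨ha0 i, mul_le_mul_of_nonneg_right ?_ (ha0 i)⟩
      exact_mod_cast cesaroNumber_le_two_pow_mul d (by omega : M ≤ i)
    · simp only [b, if_neg hi, mul_zero, le_refl, true_and]
      exact mul_nonneg (by positivity) (mul_nonneg (Nat.cast_nonneg _) (ha0 i))
  have hb : 0 ≤ b := fun k => by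
    by_cases hk : M ≤ k
    · exact Nat.add_sub_cancel' hk ▸ (hb_add (k - M)).1
    · exact (if_neg (by omega : ¬N < k)).ge
  have hsupp : Function.support (fun k => (cesaroNumber d k : ℝ) * b k) ⊆ Set.range (M + ·) := by
    intro k hk
    by_contra hkM
    refine hk ?_
    have hkN : ¬N < k := fun hNk => hkM ⟨k - M, by dsimp only; omega⟩
    simp only [b, if_neg hkN, mul_zero]
  have hinj : Function.Injective (M + ·) := add_right_injective M
  have hb_sum : Summable fun i => (cesaroNumber d (M + i) : ℝ) * b (M + i) :=
    .of_nonneg_of_le (fun i => mul_nonneg (Nat.cast_nonneg _) (hb _)) (fun i => (hb_add i).2)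
      (hsum.summable.mul_left _)
  refine ⟨b, hb, ?_, ?_, fun j hj => ?_⟩
  · exact (hinj.summable_iff fun k hk => Function.notMem_support.1 (mt (@hsupp k) hk)).1 hb_sum
  · rw [← hinj.tsum_eq hsupp, ← (hsum.mul_left _).tsum_eq]
    exact hb_sum.tsum_le_tsum (fun i => (hb_add i).2) (hsum.summable.mul_left _)
  · have hj_sum := hasSum_cesaroNumber_mul_of_comp_add hφ h0 d (by omega : M ≤ j)
    exact hj_sum.congr_fun fun i => by simp only [a, b, if_pos (by omega : N < j + i)]

theorem integrableOn_rpow_mul_exp_neg_mul_one_sub_exp_pow {a r : ℝ} (ha : 0 < a) (hr : 0 < r)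
    (m : ℕ) :
    IntegrableOn (fun t : ℝ => t ^ (a - 1) * Real.exp (-(r * t)) * (1 - Real.exp (-t)) ^ m)
      (Set.Ioi 0) := by
  have hGamma : IntegrableOn (fun t : ℝ => t ^ (a - 1) * Real.exp (-(r * t))) (Set.Ioi 0) := by
    simpa using integrableOn_rpow_mul_exp_neg_mul_rpow (s := a - 1) (by linarith) one_pos hr
  refine hGamma.mul_bdd (c := 1) (by fun_prop) ?_
  filter_upwards [ae_restrict_mem measurableSet_Ioi] with t ht
  have hexp : Real.exp (-t) ≤ 1 := Real.exp_le_one_iff.2 (neg_nonpos.2 (le_of_lt ht))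
  rw [norm_pow, Real.norm_of_nonneg (sub_nonneg.2 hexp)]
  exact pow_le_one₀ (sub_nonneg.2 hexp) (by linarith [Real.exp_pos (-t)])

theorem decrement_pow_rpow_neg_mul_Gamma {a c : ℝ} (ha : 0 < a) (hc : 0 < c) (m k : ℕ) :
    (decrement ^ m) (fun k : ℕ => ((k : ℝ) + c) ^ (-a)) k * Real.Gamma a =
      ∫ t in Set.Ioi (0 : ℝ),
        t ^ (a - 1) * Real.exp (-(((k : ℝ) + c) * t)) * (1 - Real.exp (-t)) ^ m := by
  induction m generalizing k with
  | zero =>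
    have hk : 0 < (k : ℝ) + c := by positivity
    simp only [pow_zero, mul_one, Module.End.one_apply]
    rw [Real.integral_rpow_mul_exp_neg_mul_Ioi ha hk, one_div, Real.inv_rpow hk.le,
      Real.rpow_neg hk.le]
  | succ m ih =>
    rw [pow_succ', Module.End.mul_apply, decrement_apply, sub_mul, ih, ih, ← integral_sub
      (integrableOn_rpow_mul_exp_neg_mul_one_sub_exp_pow ha (by positivity) m)
      (integrableOn_rpow_mul_exp_neg_mul_one_sub_exp_pow ha (by positivity) m)]
    congr 1 with t
    have hexp : Real.exp (-(((k + 1 : ℕ) + c) * t)) =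
        Real.exp (-((k + c) * t)) * Real.exp (-t) := by
      rw [← Real.exp_add]
      push_cast
      ring_nf
    rw [hexp]
    ring

theorem completelyMonotone_rpow_neg {a c : ℝ} (ha : 0 < a) (hc : 0 < c) :
    CompletelyMonotone fun k => ((k : ℝ) + c) ^ (-a) := by
  intro m k
  refine nonneg_of_mul_nonneg_left ?_ (Real.Gamma_pos_of_pos ha)
  rw [decrement_pow_rpow_neg_mul_Gamma ha hc]
  refine setIntegral_nonneg measurableSet_Ioi fun t (ht : 0 < t) => ?_
  have hexp : 0 ≤ 1 - Real.exp (-t) := sub_nonneg.2 (Real.exp_le_one_iff.2 (neg_nonpos.2 ht.le))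
  positivity

theorem theta_eq {n : ℕ} (hn : 1 ≤ n) (k : ℕ) : theta n k = k * (k + (2 * n - 2)) := by
  rw [theta, realDim, Nat.cast_sub (by omega)]
  push_cast
  ring

theorem theta_pos {n : ℕ} (hn : 1 ≤ n) {k : ℕ} (hk : 1 ≤ k) : 0 < theta n k := by
  have hn' : (1 : ℝ) ≤ n := by exact_mod_cast hn
  have hk' : (1 : ℝ) ≤ k := by exact_mod_cast hk
  rw [theta_eq hn]
  exact mul_pos (by linarith) (by linarith)

theorem theta_rpow_neg_le {n : ℕ} (hn : 1 ≤ n) {γ : ℝ} (hγ : 0 ≤ γ) {k : ℕ} (hk : 1 ≤ k) :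
    theta n k ^ (-(γ / 2)) ≤ (k : ℝ) ^ (-γ) := by
  have hk' : (0 : ℝ) < k := by exact_mod_cast hk
  have hn' : (1 : ℝ) ≤ n := by exact_mod_cast hn
  have hsq : (k : ℝ) ^ 2 ≤ theta n k := by rw [theta_eq hn]; nlinarith
  calc theta n k ^ (-(γ / 2)) ≤ ((k : ℝ) ^ 2) ^ (-(γ / 2)) :=
        Real.rpow_le_rpow_of_nonpos (by positivity) hsq (by linarith)
    _ = (k : ℝ) ^ (-γ) := by
        rw [← Real.rpow_natCast, ← Real.rpow_mul hk'.le]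
        push_cast
        ring_nf

theorem completelyMonotone_theta_rpow_neg {n : ℕ} (hn : 1 ≤ n) {γ : ℝ} (hγ : 0 < γ) {M : ℕ}
    (hM : 1 ≤ M) : CompletelyMonotone fun i => theta n (M + i) ^ (-(γ / 2)) := by
  have hn' : (1 : ℝ) ≤ n := by exact_mod_cast hn
  have hM' : (1 : ℝ) ≤ M := by exact_mod_cast hM
  have hc : (0 : ℝ) < M + (2 * n - 2) := by linarith
  convert (completelyMonotone_rpow_neg (half_pos hγ) (by positivity : (0 : ℝ) < M)).mul
    (completelyMonotone_rpow_neg (half_pos hγ) hc) using 1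
  ext i
  rw [Pi.mul_apply, ← Real.mul_rpow (by positivity) (by positivity), theta_eq hn]
  push_cast
  ring_nf

theorem tendsto_theta_rpow_neg {n : ℕ} (hn : 1 ≤ n) {γ : ℝ} (hγ : 0 < γ) :
    Tendsto (fun k => theta n k ^ (-(γ / 2))) atTop (𝓝 0) := by
  refine squeeze_zero' ?_ ?_ ((tendsto_rpow_neg_atTop hγ).comp tendsto_natCast_atTop_atTop)
  · filter_upwards [eventually_ge_atTop 1] with k hk
    exact (completelyMonotone_theta_rpow_neg hn hγ hk).nonneg 0
  · filter_upwards [eventually_ge_atTop 1] with k hk using theta_rpow_neg_le hn hγ.le hk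

theorem exists_cesaro_weights_theta {n : ℕ} (hn : 1 ≤ n) {γ : ℝ} (hγ : 0 < γ) (d : ℕ) {N : ℕ}
    (hN : 1 ≤ N) :
    ∃ b : ℕ → ℝ, 0 ≤ b ∧ (Summable fun k => (cesaroNumber d k : ℝ) * b k) ∧
      ∑' k, (cesaroNumber d k : ℝ) * b k ≤ 2 ^ d * 2 ^ γ * (N : ℝ) ^ (-γ) ∧
      ∀ j, N < j → HasSum (fun i => (cesaroNumber d i : ℝ) * b (j + i))
        (theta n j ^ (-(γ / 2))) := by
  obtain ⟨M, hM, hMN, hNM⟩ : ∃ M, 1 ≤ M ∧ 2 * M ≤ N + 1 ∧ N ≤ 2 * M :=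
    ⟨(N + 1) / 2, by omega, by omega, by omega⟩
  obtain ⟨b, hb, hsum, hle, hb_sum⟩ := exists_cesaro_weights d
    (completelyMonotone_theta_rpow_neg hn hγ hM) (tendsto_theta_rpow_neg hn hγ) hMN
  refine ⟨b, hb, hsum, hle.trans ?_, hb_sum⟩
  have hN' : (0 : ℝ) < N := by exact_mod_cast hN
  have hNM' : (N : ℝ) / 2 ≤ M := (div_le_iff₀' two_pos).2 (by exact_mod_cast hNM)
  rw [mul_assoc]
  gcongr
  calc theta n M ^ (-(γ / 2)) ≤ (M : ℝ) ^ (-γ) := theta_rpow_neg_le hn hγ.le hM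
    _ ≤ ((N : ℝ) / 2) ^ (-γ) :=
        Real.rpow_le_rpow_of_nonpos (by positivity) hNM' (by linarith)
    _ = 2 ^ γ * (N : ℝ) ^ (-γ) := by
        rw [Real.div_rpow hN'.le zero_le_two, Real.rpow_neg zero_le_two, div_inv_eq_mul, mul_comm]

end CompletelyMonotone

section Laplacian

open InnerProductSpace
open scoped RealInnerProductSpace

variable {E : Type*} [NormedAddCommGroup E] [InnerProductSpace ℝ E]

theorem contDiffAt_inv_norm {y : E} (hy : y ≠ 0) {k : WithTop ℕ∞} :
    ContDiffAt ℝ k (fun z : E => ‖z‖⁻¹) y :=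
  (contDiffAt_norm ℝ hy).inv (norm_ne_zero_iff.2 hy)

theorem hasFDerivAt_inner (x y : E) : HasFDerivAt (fun z => ⟪x, z⟫) (innerSL ℝ x) y :=
  (innerSL ℝ x).hasFDerivAt

theorem contDiff_inner (x : E) {k : WithTop ℕ∞} : ContDiff ℝ k fun z => ⟪x, z⟫ :=
  (innerSL ℝ x).contDiff

theorem hasFDerivAt_inv_norm {y : E} (hy : y ≠ 0) :
    HasFDerivAt (fun z : E => ‖z‖⁻¹) (-(‖y‖⁻¹ ^ 3) • innerSL ℝ y) y := by
  have hnorm : ‖y‖ ≠ 0 := norm_ne_zero_iff.2 hy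
  have hsq : HasFDerivAt (fun z : E => ‖z‖ ^ 2) (2 • innerSL ℝ y) y :=
    (hasStrictFDerivAt_norm_sq y).hasFDerivAt
  have hinv := (hasDerivAt_inv (Real.sqrt_ne_zero'.2 (by positivity))).comp_hasFDerivAt y
    (hsq.sqrt (pow_ne_zero 2 hnorm))
  simp only [Function.comp_def, Real.sqrt_sq (norm_nonneg _)] at hinv
  refine hinv.congr_fderiv ?_
  ext z
  simp only [smul_apply, nsmul_eq_mul, smul_eq_mul, Nat.cast_ofNat]
  field_simp

variable [FiniteDimensional ℝ E] {A : Type*} [NormedCommRing A] [NormedAlgebra ℝ A]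

theorem laplacian_eq_sum_fderiv {F : Type*} [NormedAddCommGroup F] [NormedSpace ℝ F] {f : E → F}
    {x : E} (hf : ContDiffAt ℝ 2 f x) :
    Δ f x = ∑ i, fderiv ℝ (fun y => fderiv ℝ f y (stdOrthonormalBasis ℝ E i)) x
      (stdOrthonormalBasis ℝ E i) := by
  have hf' : DifferentiableAt ℝ (fderiv ℝ f) x :=
    (hf.fderiv_right (m := 1) le_rfl).differentiableAt one_ne_zero
  rw [laplacian_eq_iteratedFDeriv_stdOrthonormalBasis]
  refine Finset.sum_congr rfl fun i _ => ?_
  rw [iteratedFDeriv_two_apply, fderiv_clm_apply hf' (by fun_prop)]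
  simp

theorem laplacian_mul {f g : E → A} {x : E} (hf : ContDiffAt ℝ 2 f x) (hg : ContDiffAt ℝ 2 g x) :
    Δ (fun y => f y * g y) x = f x * Δ g x + g x * Δ f x + 2 * ∑ i,
      fderiv ℝ f x (stdOrthonormalBasis ℝ E i) * fderiv ℝ g x (stdOrthonormalBasis ℝ E i) := by
  have hdiff {h : E → A} (hh : ContDiffAt ℝ 2 h x) : ∀ᶠ y in nhds x, DifferentiableAt ℝ h y := by
    filter_upwards [hh.eventually (by simp)] with y hy using hy.differentiableAt two_ne_zero
  have hdiff' {h : E → A} (hh : ContDiffAt ℝ 2 h x) (e : E) :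
      DifferentiableAt ℝ (fun y => fderiv ℝ h y e) x :=
    ((hh.fderiv_right (m := 1) le_rfl).clm_apply contDiffAt_const).differentiableAt one_ne_zero
  rw [laplacian_eq_sum_fderiv (hf.mul hg), laplacian_eq_sum_fderiv hf, laplacian_eq_sum_fderiv hg]
  simp only [Finset.mul_sum, ← Finset.sum_add_distrib]
  refine Finset.sum_congr rfl fun i _ => ?_
  set e := stdOrthonormalBasis ℝ E i
  have hmul : (fun y => fderiv ℝ (fun y => f y * g y) y e) =ᶠ[nhds x]
      fun y => f y * fderiv ℝ g y e + g y * fderiv ℝ f y e := by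
    filter_upwards [hdiff hf, hdiff hg] with y hfy hgy
    simp [fderiv_fun_mul hfy hgy]
  have hf1 := (hdiff hf).self_of_nhds
  have hg1 := (hdiff hg).self_of_nhds
  rw [hmul.fderiv_eq, fderiv_fun_add (hf1.fun_mul (hdiff' hg e)) (hg1.fun_mul (hdiff' hf e)),
    fderiv_fun_mul hf1 (hdiff' hg e), fderiv_fun_mul hg1 (hdiff' hf e)]
  simp only [add_apply, smul_apply, smul_eq_mul]
  ring

theorem laplacian_comp {g : ℝ → ℝ} {f : E → ℝ} {x : E} (hg : ContDiff ℝ 2 g)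
    (hf : ContDiffAt ℝ 2 f x) :
    Δ (fun y => g (f y)) x = deriv g (f x) * Δ f x +
      deriv (deriv g) (f x) * ∑ i, fderiv ℝ f x (stdOrthonormalBasis ℝ E i) ^ 2 := by
  have hg' : ContDiff ℝ 1 (deriv g) := (contDiff_succ_iff_deriv.1 hg).2.2
  have hfderiv {h : ℝ → ℝ} {y : E} (hh : ContDiff ℝ 1 h) (hfy : DifferentiableAt ℝ f y) (e : E) :
      fderiv ℝ (fun z => h (f z)) y e = deriv h (f y) * fderiv ℝ f y e := by
    have := ((hh.differentiable one_ne_zero).differentiableAt.hasDerivAt.comp_hasFDerivAt y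
      hfy.hasFDerivAt).fderiv
    simp only [Function.comp_def] at this
    rw [this, smul_apply, smul_eq_mul]
  have hf1 := hf.differentiableAt two_ne_zero
  rw [laplacian_eq_sum_fderiv (hg.contDiffAt.fun_comp x hf), laplacian_eq_sum_fderiv hf]
  simp only [Finset.mul_sum, ← Finset.sum_add_distrib]
  refine Finset.sum_congr rfl fun i _ => ?_
  set e := stdOrthonormalBasis ℝ E i
  have hcomp : (fun y => fderiv ℝ (fun z => g (f z)) y e) =ᶠ[nhds x]
      fun y => deriv g (f y) * fderiv ℝ f y e := by
    filter_upwards [hf.eventually (by simp)] with y hy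
    exact hfderiv (hg.of_le one_le_two) (hy.differentiableAt two_ne_zero) e
  have hf2 : DifferentiableAt ℝ (fun y => fderiv ℝ f y e) x :=
    ((hf.fderiv_right (m := 1) le_rfl).clm_apply contDiffAt_const).differentiableAt one_ne_zero
  have hg1 : DifferentiableAt ℝ (fun y => deriv g (f y)) x :=
    (hg'.differentiable one_ne_zero).differentiableAt.fun_comp' x hf1
  rw [hcomp.fderiv_eq, fderiv_fun_mul hg1 hf2]
  simp only [add_apply, smul_apply, smul_eq_mul, hfderiv hg' hf1]
  ring

theorem sum_inner_stdOrthonormalBasis_mul (x y : E) :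
    ∑ i, ⟪x, stdOrthonormalBasis ℝ E i⟫ * ⟪y, stdOrthonormalBasis ℝ E i⟫ = ⟪x, y⟫ := by
  simp only [← (stdOrthonormalBasis ℝ E).sum_inner_mul_inner x y, real_inner_comm y]

theorem laplacian_inv_norm {y : E} (hy : ‖y‖ = 1) :
    Δ (fun z : E => ‖z‖⁻¹) y = 3 - Module.finrank ℝ E := by
  have hy0 : y ≠ 0 := ne_zero_of_norm_ne_zero (by rw [hy]; exact one_ne_zero)
  have hfderiv (e : E) (he : ‖e‖ = 1) :
      fderiv ℝ (fun z => fderiv ℝ (fun z : E => ‖z‖⁻¹) z e) y e = 3 * (⟪y, e⟫ * ⟪y, e⟫) - 1 := by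
    have heq : (fun z => fderiv ℝ (fun z : E => ‖z‖⁻¹) z e) =ᶠ[nhds y]
        fun z => -(‖z‖⁻¹ ^ 3) * ⟪e, z⟫ := by
      filter_upwards [isOpen_compl_singleton.mem_nhds hy0] with z hz
      simp [(hasFDerivAt_inv_norm hz).fderiv, real_inner_comm]
    rw [heq.fderiv_eq,
      (((hasFDerivAt_inv_norm hy0).pow 3).fun_neg.fun_mul (hasFDerivAt_inner e y)).fderiv]
    simp [hy, he, real_inner_comm]
    ring
  rw [laplacian_eq_sum_fderiv (contDiffAt_inv_norm hy0),
    Finset.sum_congr rfl fun i _ => hfderiv _ ((stdOrthonormalBasis ℝ E).norm_eq_one i),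
    Finset.sum_sub_distrib, ← Finset.mul_sum, sum_inner_stdOrthonormalBasis_mul,
    real_inner_self_eq_norm_sq, hy]
  simp

theorem laplacian_inner (x y : E) : Δ (fun z => ⟪x, z⟫) y = 0 := by
  rw [laplacian_eq_sum_fderiv (contDiff_inner x).contDiffAt]
  simp [fun z => (hasFDerivAt_inner x z).fderiv]

theorem laplacian_comp_inv_norm_mul_inner {g : ℝ → ℝ} (hg : ContDiff ℝ 2 g) {x y : E}
    (hx : ‖x‖ = 1) (hy : ‖y‖ = 1) :
    Δ (fun z => g (‖z‖⁻¹ * ⟪x, z⟫)) y = (1 - ⟪x, y⟫ ^ 2) * deriv (deriv g) ⟪x, y⟫ -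
      (Module.finrank ℝ E - 1) * ⟪x, y⟫ * deriv g ⟪x, y⟫ := by
  have hy0 : y ≠ 0 := ne_zero_of_norm_ne_zero (by rw [hy]; exact one_ne_zero)
  have hgrad (v : E) : fderiv ℝ (fun z => ‖z‖⁻¹ * ⟪x, z⟫) y v = ⟪x - ⟪x, y⟫ • y, v⟫ := by
    rw [((hasFDerivAt_inv_norm hy0).fun_mul (hasFDerivAt_inner x y)).fderiv]
    simp [hy, inner_sub_left, real_inner_smul_left]
    ring
  have hlap : Δ (fun z => ‖z‖⁻¹ * ⟪x, z⟫) y = (1 - Module.finrank ℝ E) * ⟪x, y⟫ := by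
    rw [laplacian_mul (contDiffAt_inv_norm hy0) (contDiff_inner x).contDiffAt,
      laplacian_inv_norm hy,
      laplacian_inner, (hasFDerivAt_inv_norm hy0).fderiv, (hasFDerivAt_inner x y).fderiv]
    simp only [smul_apply, innerSL_apply_apply, smul_eq_mul, hy, inv_one, one_pow, one_mul,
      neg_mul, Finset.sum_neg_distrib, sum_inner_stdOrthonormalBasis_mul, real_inner_comm x y]
    ring
  rw [laplacian_comp hg ((contDiffAt_inv_norm hy0).mul (contDiff_inner x).contDiffAt), hlap]
  simp only [hgrad, sq (inner ℝ _ _), sum_inner_stdOrthonormalBasis_mul, hy, inv_one, one_mul]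
  rw [real_inner_self_eq_norm_sq, norm_sub_sq_real, norm_smul, hx, hy, real_inner_smul_right,
    mul_one, Real.norm_eq_abs, sq_abs]
  ring

end Laplacian

section Geometry

open Polynomial
open scoped RealInnerProductSpace

variable {n : ℕ}

theorem coe_ne_zero (x : CSphere n) : (x : EuclideanSpace ℂ (Fin n)) ≠ 0 :=
  ne_zero_of_mem_unit_sphere x

theorem norm_coe (x : CSphere n) : ‖(x : EuclideanSpace ℂ (Fin n))‖ = 1 :=
  norm_eq_of_mem_sphere x

theorem radialExt_of_ne_zero (u : CSphere n → ℂ) {y : EuclideanSpace ℂ (Fin n)} (hy : y ≠ 0) :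
    radialExt u y = u ⟨‖y‖⁻¹ • y, by simp [norm_smul, hy]⟩ :=
  dif_pos _

theorem radialExt_coe (u : CSphere n → ℂ) (x : CSphere n) : radialExt u x = u x := by
  simp [radialExt_of_ne_zero u (coe_ne_zero x)]

/-- The cosine `⟪x, y⟫` of the geodesic distance of two points of the sphere. -/
def cosAngle (x y : CSphere n) : ℝ :=
  ⟪(x : EuclideanSpace ℂ (Fin n)), (y : EuclideanSpace ℂ (Fin n))⟫

/-- The zonal function with profile `p` and pole `x`. -/
def zonalFun (p : ℝ[X]) (x y : CSphere n) : ℂ := ((p.eval (cosAngle x y) : ℝ) : ℂ)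

theorem radialExt_zonalFun (p : ℝ[X]) (x : CSphere n) {y : EuclideanSpace ℂ (Fin n)}
    (hy : y ≠ 0) : radialExt (zonalFun p x) y =
      ((p.eval (‖y‖⁻¹ * ⟪(x : EuclideanSpace ℂ (Fin n)), y⟫) : ℝ) : ℂ) := by
  rw [radialExt_of_ne_zero _ hy, zonalFun, cosAngle, inner_smul_right_eq_smul, smul_eq_mul]

theorem contDiffAt_eval_inv_norm_mul_inner (p : ℝ[X]) (x : CSphere n)
    {y : EuclideanSpace ℂ (Fin n)} (hy : y ≠ 0) {k : WithTop ℕ∞} :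
    ContDiffAt ℝ k (fun z => p.eval (‖z‖⁻¹ * ⟪(x : EuclideanSpace ℂ (Fin n)), z⟫)) y :=
  (p.contDiff_aeval k).contDiffAt.fun_comp y
    ((contDiffAt_inv_norm hy).mul (contDiff_inner _).contDiffAt)

theorem isSmooth_zonalFun (p : ℝ[X]) (x : CSphere n) : IsSmooth (zonalFun p x) := by
  refine ContDiffOn.congr (fun y hy => ?_) fun y hy => radialExt_zonalFun p x hy
  exact (Complex.ofRealCLM.contDiff.contDiffAt.fun_comp y
    (contDiffAt_eval_inv_norm_mul_inner p x hy)).contDiffWithinAt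

theorem finrank_real_euclideanSpace_complex (n : ℕ) :
    Module.finrank ℝ (EuclideanSpace ℂ (Fin n)) = 2 * n := by
  rw [← Module.finrank_mul_finrank ℝ ℂ, Complex.finrank_real_complex, finrank_euclideanSpace_fin]

theorem laplaceBeltrami_zonalFun (p : ℝ[X]) (x y : CSphere n) :
    laplaceBeltrami (zonalFun p x) y =
      -(((1 - cosAngle x y ^ 2) * (derivative (derivative p)).eval (cosAngle x y) -
        (2 * n - 1) * cosAngle x y * (derivative p).eval (cosAngle x y) : ℝ) : ℂ) := by
  have hderiv (q : ℝ[X]) : (deriv fun t => q.eval t) = fun t => (derivative q).eval t :=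
    funext fun _ => q.deriv
  have heq : radialExt (zonalFun p x) =ᶠ[nhds (y : EuclideanSpace ℂ (Fin n))]
      Complex.ofRealCLM ∘ fun z => p.eval (‖z‖⁻¹ * ⟪(x : EuclideanSpace ℂ (Fin n)), z⟫) := by
    filter_upwards [isOpen_compl_singleton.mem_nhds (coe_ne_zero y)] with z hz
    exact radialExt_zonalFun p x hz
  rw [laplaceBeltrami, (InnerProductSpace.laplacian_congr_nhds heq).self_of_nhds,
    (contDiffAt_eval_inv_norm_mul_inner p x (coe_ne_zero y)).laplacian_CLM_comp_left,
    Function.comp_apply, laplacian_comp_inv_norm_mul_inner (g := fun t => p.eval t)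
      (p.contDiff_aeval 2) (norm_coe x) (norm_coe y), finrank_real_euclideanSpace_complex]
  simp [cosAngle, hderiv]

theorem zonalFun_zonal_mem_eigenspace (hn : 1 ≤ n) (j : ℕ) (x : CSphere n) :
    zonalFun (zonal n j) x ∈ eigenspace n j := by
  refine ⟨isSmooth_zonalFun _ x, fun y => ?_⟩
  have hode := congrArg (eval (cosAngle x y)) (zonal_gegenbauer_ode n j)
  simp only [eval_add, eval_sub, eval_mul, eval_one, eval_pow, eval_X, eval_ofNat, eval_natCast,
    eval_zero] at hode
  rw [laplaceBeltrami_zonalFun, zonalFun, theta_eq hn, ← Complex.ofReal_neg, ← Complex.ofReal_mul]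
  congr 1
  linear_combination -hode

end Geometry

section RadiallyConstant

open InnerProductSpace
open scoped RealInnerProductSpace

variable {E F : Type*} [NormedAddCommGroup E] [NormedSpace ℝ E] [NormedAddCommGroup F]
  [NormedSpace ℝ F] {U V : E → F}

/-- Functions that are constant on open rays from the origin, such as the extensions `radialExt u`
of functions on the sphere. -/
def RadiallyConstant (U : E → F) : Prop := ∀ ⦃c : ℝ⦄, 0 < c → ∀ x, U (c • x) = U x

theorem RadiallyConstant.fderiv_self (hU : RadiallyConstant U) (x : E) : fderiv ℝ U x x = 0 := by
  by_cases hd : DifferentiableAt ℝ U x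
  · have hline : HasDerivAt (fun s : ℝ => s • x) x 1 := by
      simpa using (hasDerivAt_id (1 : ℝ)).smul_const x
    have hderiv : HasDerivAt (fun s : ℝ => U (s • x)) (fderiv ℝ U x x) 1 :=
      HasFDerivAt.comp_hasDerivAt 1 (by simpa using hd.hasFDerivAt) hline
    have hconst : (fun _ => U x) =ᶠ[nhds 1] fun s : ℝ => U (s • x) := by
      filter_upwards [lt_mem_nhds one_pos] with s hs using (hU hs x).symm
    exact (hderiv.congr_of_eventuallyEq hconst).unique (hasDerivAt_const _ _)
  · rw [fderiv_zero_of_not_differentiableAt hd, zero_apply]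

end RadiallyConstant

section Green

open InnerProductSpace
open scoped RealInnerProductSpace

variable {E : Type*} [NormedAddCommGroup E]

/-- A smooth bump supported in `[1 / 2, 3 / 2]`, a profile for radial cutoffs. -/
def shellBump : ContDiffBump (1 : ℝ) := ⟨1 / 4, 1 / 2, by norm_num, by norm_num⟩

/-- A smooth radial cutoff supported in a shell around the unit sphere. The factor `‖x‖ ^ 2`
compensates the homogeneity of degree `-2` of the Laplacian of a radially constant function. -/
def shellCutoff (x : E) : ℂ := ((‖x‖ ^ 2 * shellBump (‖x‖ ^ 2) : ℝ) : ℂ)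

theorem shellCutoff_eventuallyEq_zero : shellCutoff =ᶠ[nhds (0 : E)] fun _ => 0 := by
  have hcont : ContinuousAt (fun x : E => ‖x‖ ^ 2) 0 := by fun_prop
  filter_upwards [hcont.eventually (gt_mem_nhds (show ‖(0 : E)‖ ^ 2 < 1 / 2 by simp))] with x hx
  have hdist : 1 / 2 ≤ dist (‖x‖ ^ 2) 1 := le_abs.2 (Or.inr (by linarith))
  simp [shellCutoff, shellBump.zero_of_le_dist hdist]

variable [InnerProductSpace ℝ E]

theorem contDiff_shellCutoff : ContDiff ℝ ∞ (shellCutoff : E → ℂ) :=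
  Complex.ofRealCLM.contDiff.comp
    ((contDiff_norm_sq ℝ).mul (shellBump.contDiff.comp (contDiff_norm_sq ℝ)))

theorem contDiff_shellCutoff_mul {U : E → ℂ} (hU : ContDiffOn ℝ ∞ U {0}ᶜ) :
    ContDiff ℝ ∞ fun x => shellCutoff x * U x := by
  rw [contDiff_iff_contDiffAt]
  intro x
  by_cases hx : x = 0
  · refine contDiffAt_const (c := 0) |>.congr_of_eventuallyEq ?_
    filter_upwards [hx ▸ shellCutoff_eventuallyEq_zero] with y hy
    rw [hy, zero_mul]
  · exact contDiff_shellCutoff.contDiffAt.mul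
      (hU.contDiffAt (isOpen_compl_singleton.mem_nhds hx))

theorem exists_fderiv_shellCutoff_eq (x : E) :
    ∃ c : ℂ, ∀ v, fderiv ℝ shellCutoff x v = c * (⟪x, v⟫ : ℝ) := by
  have hprofile : DifferentiableAt ℝ (fun t => t * shellBump t) (‖x‖ ^ 2) :=
    differentiableAt_id.mul (shellBump.contDiffAt.differentiableAt (n := 1) one_ne_zero)
  have hcutoff : HasFDerivAt (shellCutoff : E → ℂ) _ x := Complex.ofRealCLM.hasFDerivAt.comp x
    (HasDerivAt.comp_hasFDerivAt (f := fun x : E => ‖x‖ ^ 2) x hprofile.hasDerivAt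
      (hasStrictFDerivAt_norm_sq x).hasFDerivAt)
  refine ⟨deriv (fun t => t * shellBump t) (‖x‖ ^ 2) * 2, fun v => ?_⟩
  rw [hcutoff.fderiv]
  simp [mul_assoc]

variable [FiniteDimensional ℝ E]

theorem hasCompactSupport_shellCutoff : HasCompactSupport (shellCutoff : E → ℂ) := by
  refine HasCompactSupport.intro (isCompact_closedBall (0 : E) 2) fun x hx => ?_
  have hx' : 2 < ‖x‖ := by simpa using hx
  have hdist : 1 / 2 ≤ dist (‖x‖ ^ 2) 1 := le_abs.2 (Or.inl (by nlinarith))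
  simp [shellCutoff, shellBump.zero_of_le_dist hdist]

theorem RadiallyConstant.laplacian_smul {F : Type*} [NormedAddCommGroup F] [NormedSpace ℝ F]
    {U : E → F} (hU : RadiallyConstant U) {c : ℝ} (hc : 0 < c) (x : E) :
    Δ U (c • x) = (c ^ 2)⁻¹ • Δ U x := by
  have hfderiv (y : E) : fderiv ℝ U y = c • fderiv ℝ U (c • y) := by
    rw [← fderiv_comp_smul]
    exact congrArg (fderiv ℝ · y) (funext fun z => (hU hc z).symm)
  have hfderiv₂ : fderiv ℝ (fderiv ℝ U) x = c • c • fderiv ℝ (fderiv ℝ U) (c • x) := by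
    rw [← fderiv_comp_smul (f := fderiv ℝ U)]
    refine (congrArg (fderiv ℝ · x) (funext hfderiv)).trans ?_
    exact congrFun (fderiv_const_smul_field (𝕜 := ℝ) (f := fun y => fderiv ℝ U (c • y)) c) x
  simp only [laplacian_eq_iteratedFDeriv_stdOrthonormalBasis, iteratedFDeriv_two_apply, hfderiv₂,
    smul_apply, ← Finset.smul_sum]
  rw [smul_smul c, ← sq, inv_smul_smul₀ (by positivity)]

theorem RadiallyConstant.laplacian_shellCutoff_mul {U : E → ℂ} (hU : RadiallyConstant U) {x : E}
    (hx : ContDiffAt ℝ 2 U x) :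
    Δ (fun y => shellCutoff y * U y) x =
      shellCutoff x * Δ U x + U x * Δ (shellCutoff : E → ℂ) x := by
  have hgrad : ∑ i, fderiv ℝ shellCutoff x (stdOrthonormalBasis ℝ E i) *
      fderiv ℝ U x (stdOrthonormalBasis ℝ E i) = 0 := by
    obtain ⟨c, hc⟩ := exists_fderiv_shellCutoff_eq x
    calc _ = c * fderiv ℝ U x
            (∑ i, ⟪stdOrthonormalBasis ℝ E i, x⟫ • stdOrthonormalBasis ℝ E i) := by
          simp only [map_sum, map_smul, Complex.real_smul, Finset.mul_sum, hc, mul_assoc,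
            real_inner_comm]
      _ = 0 := by rw [OrthonormalBasis.sum_repr', hU.fderiv_self, mul_zero]
  rw [laplacian_mul (contDiff_shellCutoff.contDiffAt.of_le (WithTop.coe_le_coe.2 le_top)) hx,
    hgrad, mul_zero, add_zero]

variable [MeasurableSpace E] [BorelSpace E] (μ : Measure E) [μ.IsAddHaarMeasure]

theorem integral_shellCutoff_sq_mul_laplacian {U V : E → ℂ} (hU : RadiallyConstant U)
    (hV : RadiallyConstant V) (hU' : ContDiffOn ℝ ∞ U {0}ᶜ) (hV' : ContDiffOn ℝ ∞ V {0}ᶜ) :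
    ∫ x, shellCutoff x ^ 2 * (U x * Δ V x - V x * Δ U x) ∂μ = 0 := by
  set f : SchwartzMap E ℂ :=
    hasCompactSupport_shellCutoff.mul_right.toSchwartzMap (contDiff_shellCutoff_mul hU')
  set g : SchwartzMap E ℂ :=
    hasCompactSupport_shellCutoff.mul_right.toSchwartzMap (contDiff_shellCutoff_mul hV')
  have hpointwise (x : E) :
      shellCutoff x ^ 2 * (U x * Δ V x - V x * Δ U x) = f x * Δ g x - Δ f x * g x := by
    rw [SchwartzMap.laplacian_apply, SchwartzMap.laplacian_apply]
    change _ = shellCutoff x * U x * Δ (fun y => shellCutoff y * V y) x -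
      Δ (fun y => shellCutoff y * U y) x * (shellCutoff x * V x)
    by_cases hx : x = 0
    · simp [hx, shellCutoff_eventuallyEq_zero.self_of_nhds]
    · have hsmooth {W : E → ℂ} (hW : ContDiffOn ℝ ∞ W {0}ᶜ) : ContDiffAt ℝ 2 W x :=
        (hW.contDiffAt (isOpen_compl_singleton.mem_nhds hx)).of_le (WithTop.coe_le_coe.2 le_top)
      rw [hU.laplacian_shellCutoff_mul (hsmooth hU'), hV.laplacian_shellCutoff_mul (hsmooth hV')]
      ring
  simp only [hpointwise]
  have hint (f g : SchwartzMap E ℂ) : Integrable (fun x => f x * g x) μ :=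
    (SchwartzMap.pairing (.mul ℝ ℂ) f g).integrable
  rw [integral_sub (hint f (Δ g)) (hint (Δ f) g),
    SchwartzMap.integral_mul_laplacian_right_eq_left, sub_self]

theorem integral_eq_integral_toSphere_mul [Nontrivial E] {f : E → ℂ} {A : sphere (0 : E) 1 → ℂ}
    {b : ℝ → ℂ} (hf : ∀ (r : ℝ) (y : sphere (0 : E) 1), 0 < r → f (r • (y : E)) = A y * b r) :
    ∫ x, f x ∂μ = (∫ y, A y ∂μ.toSphere) *
      ∫ r : Set.Ioi (0 : ℝ), b r ∂(Measure.volumeIoiPow (Module.finrank ℝ E - 1)) := by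
  calc ∫ x, f x ∂μ = ∫ x : ({0}ᶜ : Set E), f x ∂(μ.comap (↑)) := by
        rw [integral_subtype_comap (measurableSet_singleton _).compl f, restrict_compl_singleton]
    _ = ∫ x, A x.1 * b x.2 ∂μ.toSphere.prod (.volumeIoiPow (Module.finrank ℝ E - 1)) := by
        rw [← μ.measurePreserving_homeomorphUnitSphereProd.integral_comp
          (Homeomorph.measurableEmbedding _)]
        refine integral_congr_ae (.of_forall fun x => ?_)
        have hx : ‖(x : E)‖ ≠ 0 := norm_ne_zero_iff.2 x.2
        refine Eq.trans ?_ (hf _ _ (homeomorphUnitSphereProd E x).2.2)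
        simp [smul_smul, hx]
    _ = _ := integral_prod_mul A fun r : Set.Ioi (0 : ℝ) => b r

theorem integral_shellBump_ne_zero [Nontrivial E] :
    ∫ r : Set.Ioi (0 : ℝ), (((r : ℝ) ^ 2 * shellBump ((r : ℝ) ^ 2) ^ 2 : ℝ) : ℂ)
      ∂(Measure.volumeIoiPow (Module.finrank ℝ E - 1)) ≠ 0 := by
  intro hzero
  let μ : Measure E := Measure.addHaar
  have hpolar := integral_eq_integral_toSphere_mul μ (A := fun _ => 1)
    (f := fun x => ((‖x‖ ^ 2 * shellBump (‖x‖ ^ 2) ^ 2 : ℝ) : ℂ))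
    (b := fun r => ((r ^ 2 * shellBump (r ^ 2) ^ 2 : ℝ) : ℂ))
    fun r y hr => by simp [norm_smul, abs_of_pos hr]
  rw [hzero, mul_zero, integral_complex_ofReal, Complex.ofReal_eq_zero] at hpolar
  obtain ⟨x, hx⟩ := (NormedSpace.sphere_nonempty (x := (0 : E)) (r := 1)).2 zero_le_one
  have hcont : Continuous fun x : E => ‖x‖ ^ 2 * shellBump (‖x‖ ^ 2) ^ 2 := by
    have := shellBump.continuous
    fun_prop
  have hsupp : HasCompactSupport fun x : E => ‖x‖ ^ 2 * shellBump (‖x‖ ^ 2) ^ 2 := by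
    refine hasCompactSupport_shellCutoff.mono fun x hx => ?_
    simp_all [shellCutoff]
  have hone : shellBump 1 = 1 :=
    shellBump.one_of_mem_closedBall (mem_closedBall_self (by norm_num [shellBump]))
  refine (hcont.integral_pos_of_hasCompactSupport_nonneg_nonzero (μ := μ) hsupp
    (fun x => by positivity) (x := x) ?_).ne' hpolar
  simp [mem_sphere_zero_iff_norm.1 hx, hone]

theorem integral_toSphere_mul_laplacian_sub [Nontrivial E] {U V : E → ℂ} (hU : RadiallyConstant U)
    (hV : RadiallyConstant V) (hU' : ContDiffOn ℝ ∞ U {0}ᶜ) (hV' : ContDiffOn ℝ ∞ V {0}ᶜ) :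
    ∫ y : sphere (0 : E) 1, (U y * Δ V y - V y * Δ U y) ∂μ.toSphere = 0 := by
  have h := integral_shellCutoff_sq_mul_laplacian μ hU hV hU' hV'
  rw [integral_eq_integral_toSphere_mul μ (A := fun y => U y * Δ V y - V y * Δ U y)
    (b := fun r => ((r ^ 2 * shellBump (r ^ 2) ^ 2 : ℝ) : ℂ))] at h
  · exact (mul_eq_zero.1 h).resolve_right integral_shellBump_ne_zero
  · intro r y hr
    have hr' : (r : ℂ) ≠ 0 := by exact_mod_cast hr.ne'
    rw [shellCutoff, norm_smul, Real.norm_of_nonneg hr.le, norm_eq_of_mem_sphere, mul_one,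
      hU.laplacian_smul hr, hV.laplacian_smul hr, hU hr, hV hr, Complex.real_smul,
      Complex.real_smul]
    push_cast
    field_simp

end Green

section Orthogonality

variable {n : ℕ}

theorem radiallyConstant_radialExt (u : CSphere n → ℂ) : RadiallyConstant (radialExt u) := by
  intro c hc y
  by_cases hy : y = 0
  · rw [hy, smul_zero]
  · rw [radialExt_of_ne_zero u hy, radialExt_of_ne_zero u (smul_ne_zero hc.ne' hy)]
    congr 2
    rw [norm_smul, Real.norm_of_nonneg hc.le, mul_inv_rev, mul_smul, inv_smul_smul₀ hc.ne']

theorem IsSmooth.continuous {u : CSphere n → ℂ} (hu : IsSmooth u) : Continuous u := by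
  rw [← funext (radialExt_coe u)]
  exact continuous_iff_continuousAt.2 fun x =>
    (hu.contDiffAt x).continuousAt.comp continuous_subtype_val.continuousAt

theorem theta_injective (hn : 1 ≤ n) : Function.Injective (theta n) := by
  have hn' : (1 : ℝ) ≤ n := by exact_mod_cast hn
  refine (strictMono_nat_of_lt_succ fun k => ?_).injective
  rw [theta_eq hn, theta_eq hn]
  push_cast
  nlinarith [(Nat.cast_nonneg k : (0 : ℝ) ≤ k)]

variable [NeZero n]

theorem integral_mul_laplaceBeltrami_sub {u v : CSphere n → ℂ} (hu : IsSmooth u)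
    (hv : IsSmooth v) :
    ∫ y, (v y * laplaceBeltrami u y - u y * laplaceBeltrami v y) ∂(nu n) = 0 := by
  have h := integral_toSphere_mul_laplacian_sub volume (radiallyConstant_radialExt u)
    (radiallyConstant_radialExt v) hu hv
  simp only [radialExt_coe] at h
  rw [nu, integral_smul_measure, integral_congr_ae (.of_forall fun y => ?_), h, smul_zero]
  simp only [laplaceBeltrami]
  ring

instance isProbabilityMeasure_nu : IsProbabilityMeasure (nu n) := by
  refine ⟨ENNReal.inv_mul_cancel ?_ (measure_ne_top _ _)⟩
  exact Measure.measure_univ_ne_zero.2 (Measure.toSphere_ne_zero _)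

theorem integrable_of_continuous {F : Type*} [NormedAddCommGroup F] {f : CSphere n → F}
    (hf : Continuous f) : Integrable f (nu n) :=
  hf.integrable_of_hasCompactSupport (.of_compactSpace f)

theorem integral_mul_eq_zero_of_mem_eigenspace {j k : ℕ} (hjk : j ≠ k) {u v : CSphere n → ℂ}
    (hu : u ∈ eigenspace n j) (hv : v ∈ eigenspace n k) : ∫ y, u y * v y ∂(nu n) = 0 := by
  have hgreen := integral_mul_laplaceBeltrami_sub hu.1 hv.1
  have hcongr (y) : v y * laplaceBeltrami u y - u y * laplaceBeltrami v y =
      ((theta n j : ℂ) - theta n k) * (u y * v y) := by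
    rw [hu.2 y, hv.2 y]
    ring
  have htheta : (theta n j : ℂ) - theta n k ≠ 0 := sub_ne_zero.2 <|
    Complex.ofReal_injective.ne ((theta_injective NeZero.one_le).ne hjk)
  simp only [hcongr, integral_const_mul] at hgreen
  exact (mul_eq_zero.1 hgreen).resolve_left htheta

end Orthogonality

section Kernel

variable {X Y 𝕜 : Type*}

theorem span_range_proj_comp_subtype [Field 𝕜] (W : Submodule 𝕜 (X → 𝕜)) [FiniteDimensional 𝕜 W] :
    Submodule.span 𝕜 (Set.range fun x => (LinearMap.proj x).comp W.subtype) = ⊤ := by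
  rw [← Subspace.dualCoannihilator_dualAnnihilator_eq (W := Submodule.span 𝕜 _),
    ← Submodule.dualAnnihilator_bot]
  congr 1
  refine (Submodule.eq_bot_iff _).2 fun w hw => ?_
  rw [Submodule.mem_dualCoannihilator] at hw
  ext x
  exact hw _ (Submodule.subset_span ⟨x, rfl⟩)

theorem integrable_dual_comp [RCLike 𝕜] [MeasurableSpace Y] {μ : Measure Y}
    {W : Submodule 𝕜 (X → 𝕜)} [FiniteDimensional 𝕜 W] {κ : Y → W}
    (hκ : ∀ x, Integrable (fun y => (κ y : X → 𝕜) x) μ) (φ : Module.Dual 𝕜 W) :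
    Integrable (fun y => φ (κ y)) μ := by
  have hφ : φ ∈ Submodule.span 𝕜 (Set.range fun x => (LinearMap.proj x).comp W.subtype) := by
    rw [span_range_proj_comp_subtype]
    exact Submodule.mem_top
  induction hφ using Submodule.span_induction with
  | mem φ h =>
    obtain ⟨x, rfl⟩ := h
    exact hκ x
  | zero => exact integrable_zero ..
  | add φ ψ _ _ hφ hψ => exact hφ.add hψ
  | smul c φ _ hφ => exact hφ.const_mul c

theorem integral_mem_of_finiteDimensional [RCLike 𝕜] [MeasurableSpace Y] {μ : Measure Y}
    {W : Submodule 𝕜 (X → 𝕜)} [FiniteDimensional 𝕜 W] {k : X → Y → 𝕜}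
    (hk : ∀ y, (fun x => k x y) ∈ W) (hint : ∀ x, Integrable (k x) μ) :
    (fun x => ∫ y, k x y ∂μ) ∈ W := by
  let κ (y : Y) : W := ⟨fun x => k x y, hk y⟩
  let b := Module.finBasis 𝕜 W
  have hcoord (i) : Integrable (fun y => b.coord i (κ y)) μ := integrable_dual_comp hint _
  have hexpand (x : X) (y : Y) : k x y = ∑ i, b.coord i (κ y) * (b i : X → 𝕜) x := by
    calc k x y = ((∑ i, b.coord i (κ y) • b i : W) : X → 𝕜) x := by
          simp only [Module.Basis.coord_apply, b.sum_repr, κ]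
      _ = _ := by
          simp only [Submodule.coe_sum, Submodule.coe_smul, Finset.sum_apply, Pi.smul_apply,
            smul_eq_mul]
  have hsum : (fun x => ∫ y, k x y ∂μ) = ((∑ i, (∫ y, b.coord i (κ y) ∂μ) • b i : W) : X → 𝕜) := by
    funext x
    simp only [hexpand]
    rw [integral_finsetSum _ fun i _ => (hcoord i).mul_const _]
    simp [integral_mul_const]
  exact hsum ▸ Subtype.mem _

end Kernel

section ZonalConvolution

open Polynomial

variable {n : ℕ}

theorem abs_cosAngle_le_one (x y : CSphere n) : |cosAngle x y| ≤ 1 := by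
  simpa [cosAngle] using
    abs_real_inner_le_norm (x : EuclideanSpace ℂ (Fin n)) (y : EuclideanSpace ℂ (Fin n))

theorem continuous_cosAngle : Continuous fun q : CSphere n × CSphere n => cosAngle q.1 q.2 := by
  unfold cosAngle
  fun_prop

theorem zonalFun_comm (p : ℝ[X]) (x y : CSphere n) : zonalFun p x y = zonalFun p y x := by
  simp only [zonalFun, cosAngle, real_inner_comm]

theorem continuous_zonalFun (p : ℝ[X]) :
    Continuous fun q : CSphere n × CSphere n => zonalFun p q.1 q.2 :=
  Complex.continuous_ofReal.comp (p.continuous.comp continuous_cosAngle)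

theorem continuous_zonalFun_right (p : ℝ[X]) (x : CSphere n) : Continuous (zonalFun p x) :=
  (continuous_zonalFun p).comp (Continuous.prodMk_right x)

theorem exists_norm_zonalFun_le (p : ℝ[X]) : ∃ C, ∀ x y : CSphere n, ‖zonalFun p x y‖ ≤ C := by
  obtain ⟨C, hC⟩ := isCompact_univ.exists_bound_of_continuousOn
    (continuous_zonalFun (n := n) p).continuousOn
  exact ⟨C, fun x y => hC (x, y) trivial⟩

theorem finiteDimensional_span_zonalFun (p : ℝ[X]) :
    FiniteDimensional ℂ (Submodule.span ℂ (Set.range (zonalFun (n := n) p))) := by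
  let B := stdOrthonormalBasis ℝ (EuclideanSpace ℂ (Fin n))
  let coord (l) (x : CSphere n) : ℝ := inner ℝ (B l) (x : EuclideanSpace ℂ (Fin n))
  let monomial (q : Σ i : Fin (p.natDegree + 1), (Fin i → Fin (Module.finrank ℝ
      (EuclideanSpace ℂ (Fin n))))) (x : CSphere n) : ℂ := ∏ l, (coord (q.2 l) x : ℂ)
  have hexpand (y : CSphere n) : zonalFun p y = ∑ i : Fin (p.natDegree + 1), ∑ q,
      ((p.coeff i * ∏ l, coord (q l) y : ℝ) : ℂ) • monomial ⟨i, q⟩ := by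
    funext x
    rw [zonalFun, eval_eq_sum_range, Finset.sum_range, cosAngle, ← B.sum_inner_mul_inner]
    simp only [real_inner_comm (B _) (y : EuclideanSpace ℂ (Fin n)), Fintype.sum_pow,
      Finset.prod_mul_distrib, Finset.sum_apply, Pi.smul_apply, smul_eq_mul, monomial, coord]
    push_cast
    simp only [Finset.mul_sum, mul_assoc]
  have hle : Submodule.span ℂ (Set.range (zonalFun (n := n) p)) ≤
      Submodule.span ℂ (Set.range monomial) := by
    rw [Submodule.span_le]
    rintro _ ⟨y, rfl⟩
    rw [SetLike.mem_coe, hexpand]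
    exact Submodule.sum_mem _ fun i _ => Submodule.sum_mem _ fun q _ =>
      Submodule.smul_mem _ _ (Submodule.subset_span ⟨_, rfl⟩)
  have := FiniteDimensional.span_of_finite ℂ (Set.finite_range monomial)
  exact Submodule.finiteDimensional_of_le hle

/-- The convolution of `f` with the zonal function of profile `p`. For `p = zonal n j` it is the
orthogonal projection onto `eigenspace n j`. -/
def zonalConv (p : ℝ[X]) (f : CSphere n → ℂ) (x : CSphere n) : ℂ :=
  ∫ y, zonalFun p x y * f y ∂(nu n)

theorem fourierCoeff_zonalFun (p : ℝ[X]) (f : CSphere n → ℂ) (x : CSphere n) :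
    fourierCoeff f (zonalFun p x) = zonalConv p f x := by
  simp [fourierCoeff, zonalConv, zonalFun, mul_comm]

theorem zonalFun_zonal_zero (x : CSphere n) : zonalFun (zonal n 0) x = 1 := by
  funext y
  simp [zonalFun, zonal_zero]

theorem zonalConv_zonal_zero (f : CSphere n → ℂ) (x : CSphere n) :
    zonalConv (zonal n 0) f x = ∫ y, f y ∂(nu n) := by
  simp [zonalConv, zonalFun_zonal_zero]

section Integrable

variable {f g : CSphere n → ℂ}

theorem integrable_zonalFun_mul (p : ℝ[X]) (hf : Integrable f (nu n)) (x : CSphere n) :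
    Integrable (fun y => zonalFun p x y * f y) (nu n) := by
  obtain ⟨C, hC⟩ := exists_norm_zonalFun_le (n := n) p
  exact hf.bdd_mul (continuous_zonalFun_right p x).aestronglyMeasurable (.of_forall (hC x))

theorem continuous_zonalConv (p : ℝ[X]) (hf : Integrable f (nu n)) :
    Continuous (zonalConv p f) := by
  obtain ⟨C, hC⟩ := exists_norm_zonalFun_le (n := n) p
  refine continuous_of_dominated (bound := fun y => C * ‖f y‖)
    (fun x => (integrable_zonalFun_mul p hf x).aestronglyMeasurable)
    (fun x => .of_forall fun y => ?_) (hf.norm.const_mul C) (.of_forall fun y => ?_)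
  · rw [norm_mul]
    exact mul_le_mul_of_nonneg_right (hC x y) (norm_nonneg _)
  · exact ((continuous_zonalFun p).comp (Continuous.prodMk_left y)).mul continuous_const

theorem zonalConv_sub (p : ℝ[X]) (hf : Integrable f (nu n)) (hg : Integrable g (nu n)) :
    zonalConv p (f - g) = zonalConv p f - zonalConv p g := by
  funext x
  simp only [zonalConv, Pi.sub_apply, mul_sub]
  exact integral_sub (integrable_zonalFun_mul p hf x) (integrable_zonalFun_mul p hg x)

theorem zonalConv_const_smul (p : ℝ[X]) (c : ℂ) (f : CSphere n → ℂ) :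
    zonalConv p (c • f) = c • zonalConv p f := by
  funext x
  simp only [zonalConv, Pi.smul_apply, smul_eq_mul, mul_left_comm _ c, integral_const_mul]

theorem zonalConv_finsetSum {ι : Type*} (p : ℝ[X]) (s : Finset ι) {F : ι → CSphere n → ℂ}
    (hF : ∀ i ∈ s, Integrable (F i) (nu n)) :
    zonalConv p (∑ i ∈ s, F i) = ∑ i ∈ s, zonalConv p (F i) := by
  funext x
  simp only [zonalConv, Finset.sum_apply, Finset.mul_sum]
  exact integral_finsetSum s fun i hi => integrable_zonalFun_mul p (hF i hi) x

theorem zonalConv_cesaroKernel (M : ℕ) (hf : Integrable f (nu n)) :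
    zonalConv (cesaroKernel n M) f = ∑ j ∈ Finset.range (M + 1),
      (cesaroNumber (realDim n) (M - j) : ℂ) • zonalConv (zonal n j) f := by
  funext x
  have hkernel (y) : zonalFun (cesaroKernel n M) x y * f y = ∑ j ∈ Finset.range (M + 1),
      (cesaroNumber (realDim n) (M - j) : ℂ) * (zonalFun (zonal n j) x y * f y) := by
    simp only [zonalFun, cesaroKernel, eval_finsetSum, eval_mul, eval_natCast]
    push_cast
    simp only [Finset.sum_mul, mul_assoc]
  simp only [zonalConv, hkernel, Finset.sum_apply, Pi.smul_apply, smul_eq_mul]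
  rw [integral_finsetSum _ fun j _ => (integrable_zonalFun_mul _ hf x).const_mul _]
  simp only [integral_const_mul]

end Integrable

theorem continuous_of_mem_harmonicSpan {K : Finset ℕ} {u : CSphere n → ℂ}
    (hu : u ∈ harmonicSpan n K) : Continuous u := by
  obtain ⟨v, rfl⟩ := (Submodule.mem_iSup_finset_iff_exists_sum _ _).1 hu
  simpa only [Finset.sum_fn] using continuous_finsetSum K fun i _ => (v i).2.1.continuous

variable [NeZero n]

theorem integrable_zonalConv (p : ℝ[X]) {f : CSphere n → ℂ} (hf : Integrable f (nu n)) :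
    Integrable (zonalConv p f) (nu n) :=
  integrable_of_continuous (continuous_zonalConv p hf)

theorem zonalConv_zonal_mem_eigenspace (j : ℕ) {f : CSphere n → ℂ} (hf : Integrable f (nu n)) :
    zonalConv (zonal n j) f ∈ eigenspace n j := by
  have := finiteDimensional_span_zonalFun (n := n) (zonal n j)
  have hsections (y : CSphere n) : (fun x => zonalFun (zonal n j) x y * f y) ∈
      Submodule.span ℂ (Set.range (zonalFun (n := n) (zonal n j))) := by
    simp only [zonalFun_comm _ _ y, mul_comm _ (f y)]
    exact Submodule.smul_mem _ _ (Submodule.subset_span ⟨y, rfl⟩)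
  refine Submodule.span_le.2 ?_
    (integral_mem_of_finiteDimensional hsections (integrable_zonalFun_mul _ hf))
  rintro _ ⟨y, rfl⟩
  exact zonalFun_zonal_mem_eigenspace NeZero.one_le j y

theorem zonalConv_zonal_eq_zero_of_mem_eigenspace {i j : ℕ} (hji : j ≠ i) {u : CSphere n → ℂ}
    (hu : u ∈ eigenspace n i) : zonalConv (zonal n j) u = 0 :=
  funext fun x => integral_mul_eq_zero_of_mem_eigenspace hji
    (zonalFun_zonal_mem_eigenspace NeZero.one_le j x) hu

theorem zonalConv_zonal_eq_zero_of_mem_harmonicSpan {K : Finset ℕ} {j : ℕ} (hj : j ∉ K)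
    {u : CSphere n → ℂ} (hu : u ∈ harmonicSpan n K) : zonalConv (zonal n j) u = 0 := by
  obtain ⟨v, rfl⟩ := (Submodule.mem_iSup_finset_iff_exists_sum _ _).1 hu
  rw [zonalConv_finsetSum _ _ fun i _ => integrable_of_continuous (v i).2.1.continuous]
  exact Finset.sum_eq_zero fun i hi =>
    zonalConv_zonal_eq_zero_of_mem_eigenspace (ne_of_mem_of_not_mem hi hj).symm (v i).2

theorem zonalConv_cesaroKernel_of_mem_eigenspace {i M : ℕ} (hiM : i ≤ M) {u : CSphere n → ℂ}
    (hu : u ∈ eigenspace n i) : zonalConv (cesaroKernel n M) u =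
      (cesaroNumber (realDim n) (M - i) : ℂ) • zonalConv (zonal n i) u := by
  rw [zonalConv_cesaroKernel M (integrable_of_continuous hu.1.continuous)]
  refine Finset.sum_eq_single_of_mem i (Finset.mem_range_succ_iff.2 hiM) fun j _ hj => ?_
  rw [zonalConv_zonal_eq_zero_of_mem_eigenspace hj hu, smul_zero]

theorem cosAngle_eq_zonalFun (x y : CSphere n) :
    (cosAngle x y : ℂ) = (2 * (n : ℂ))⁻¹ * zonalFun (zonal n 1) x y := by
  have hn : (n : ℂ) ≠ 0 := NeZero.ne _
  simp only [zonalFun, zonal_one, eval_mul, eval_ofNat, eval_natCast, eval_X]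
  push_cast
  field_simp

theorem cosAngle_mem_eigenspace (x : CSphere n) :
    (fun y => (cosAngle x y : ℂ)) ∈ eigenspace n 1 := by
  simp only [cosAngle_eq_zonalFun]
  exact Submodule.smul_mem _ _ (zonalFun_zonal_mem_eigenspace NeZero.one_le 1 x)

theorem zonalConv_zonal_one_cosAngle (x : CSphere n) :
    zonalConv (zonal n 1) (fun y => (cosAngle x y : ℂ)) x = 1 := by
  have horth := congrFun (zonalConv_zonal_eq_zero_of_mem_eigenspace two_ne_zero
    (zonalFun_zonal_zero x ▸ zonalFun_zonal_mem_eigenspace (n := n) NeZero.one_le 0 x)) x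
  have hzonal (y : CSphere n) : zonalFun (zonal n 2) x y * (1 : CSphere n → ℂ) y =
      (n + 1) * (zonalFun (zonal n 1) x y * (cosAngle x y : ℂ) - 1) := by
    simp only [zonalFun, zonal_one, zonal_two, eval_mul, eval_ofNat, eval_natCast, eval_X,
      eval_sub, eval_add, eval_one, eval_pow, Pi.one_apply]
    push_cast
    ring
  have hint : Integrable (fun y => zonalFun (zonal n 1) x y * (cosAngle x y : ℂ)) (nu n) :=
    integrable_zonalFun_mul _
      (integrable_of_continuous (cosAngle_mem_eigenspace x).1.continuous) x
  simp only [zonalConv, hzonal, Pi.zero_apply] at horth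
  rw [integral_const_mul, integral_sub hint (integrable_const _), mul_eq_zero,
    or_iff_right (Nat.cast_add_one_ne_zero n), sub_eq_zero] at horth
  simpa [zonalConv] using horth

end ZonalConvolution

section CesaroMean

open Filter Topology Asymptotics Polynomial

theorem isEquivalent_cesaroNumber_sub (d j : ℕ) :
    (fun M : ℕ => (cesaroNumber d (M - j) : ℝ)) ~[atTop] fun M => (M : ℝ) ^ d / d.factorial := by
  have hshift : Tendsto (fun M => d + (M - j)) atTop atTop :=
    tendsto_atTop_mono (fun M => Nat.le_add_left (M - j) d) (tendsto_sub_atTop_nat j)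
  have hlinear : (fun M : ℕ => ((d + (M - j) : ℕ) : ℝ)) ~[atTop] fun M => (M : ℝ) := by
    refine (isLittleO_const_left.2 (.inr ?_) : (fun _ : ℕ => (d : ℝ) - j) =o[atTop] _).congr' ?_
      .rfl
    · exact tendsto_norm_atTop_atTop.comp tendsto_natCast_atTop_atTop
    · filter_upwards [eventually_ge_atTop j] with M hM
      push_cast [hM, Pi.sub_apply]
      ring
  exact ((isEquivalent_choose d).comp_tendsto hshift).trans ((hlinear.pow d).div .refl)

theorem tendsto_cesaroNumber_ratio (d j : ℕ) :
    Tendsto (fun M => (cesaroNumber d (M - j) : ℝ) / cesaroNumber d M) atTop (𝓝 1) := by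
  have hequiv := (isEquivalent_cesaroNumber_sub d j).trans (isEquivalent_cesaroNumber_sub d 0).symm
  exact (isEquivalent_iff_tendsto_one
    (.of_forall fun M => by exact_mod_cast (cesaroNumber_pos d M).ne')).1 hequiv

theorem exists_norm_sub_le_add_mul_dist_sq {X F : Type*} [PseudoMetricSpace X] [CompactSpace X]
    [SeminormedAddCommGroup F] {φ : X → F} (hφ : Continuous φ) {ε : ℝ} (hε : 0 < ε) :
    ∃ K, ∀ x y, ‖φ y - φ x‖ ≤ ε + K * dist x y ^ 2 := by
  obtain ⟨B, hB⟩ := isCompact_univ.exists_bound_of_continuousOn hφ.continuousOn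
  obtain ⟨δ, hδ, hclose⟩ :=
    Metric.uniformContinuous_iff.1 (CompactSpace.uniformContinuous_of_continuous hφ) ε hε
  refine ⟨2 * B / δ ^ 2, fun x y => ?_⟩
  have hB0 : 0 ≤ B := (norm_nonneg _).trans (hB x trivial)
  obtain hxy | hxy := lt_or_ge (dist y x) δ
  · have hle := (dist_eq_norm (φ y) (φ x) ▸ hclose hxy).le
    exact hle.trans (le_add_of_nonneg_right (by positivity))
  · calc ‖φ y - φ x‖ ≤ ‖φ y‖ + ‖φ x‖ := norm_sub_le _ _
      _ ≤ 2 * B := by linarith [hB x trivial, hB y trivial]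
      _ = 2 * B / δ ^ 2 * δ ^ 2 := by field_simp
      _ ≤ 2 * B / δ ^ 2 * dist x y ^ 2 := by rw [dist_comm x y]; gcongr
      _ ≤ ε + 2 * B / δ ^ 2 * dist x y ^ 2 := le_add_of_nonneg_left hε.le

variable {n : ℕ}

theorem dist_sq_eq_two_mul_one_sub_cosAngle (x y : CSphere n) :
    dist x y ^ 2 = 2 * (1 - cosAngle x y) := by
  rw [Subtype.dist_eq, dist_eq_norm, norm_sub_sq_real, norm_coe, norm_coe, cosAngle]
  ring

/-- The Cesàro means of order `realDim n` of the expansion of `f` into eigenfunctions. -/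
def cesaroMean (M : ℕ) (f : CSphere n → ℂ) : CSphere n → ℂ :=
  (cesaroNumber (realDim n) M : ℂ)⁻¹ • zonalConv (cesaroKernel n M) f

variable [NeZero n]

theorem norm_zonalFun_cesaroKernel (M : ℕ) (x y : CSphere n) :
    ‖zonalFun (cesaroKernel n M) x y‖ = (cesaroKernel n M).eval (cosAngle x y) := by
  rw [zonalFun, Complex.norm_real, Real.norm_of_nonneg]
  exact eval_cesaroKernel_nonneg (NeZero.ne n) M (abs_cosAngle_le_one x y)

theorem integral_zonalFun_cesaroKernel (M : ℕ) (x : CSphere n) :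
    ∫ y, zonalFun (cesaroKernel n M) x y ∂(nu n) = cesaroNumber (realDim n) M := by
  have h := congrFun (zonalConv_cesaroKernel_of_mem_eigenspace M.zero_le
    (zonalFun_zonal_zero x ▸ zonalFun_zonal_mem_eigenspace NeZero.one_le 0 x)) x
  simpa [zonalConv, zonalFun_zonal_zero] using h

theorem integral_norm_zonalFun_cesaroKernel (M : ℕ) (x : CSphere n) :
    ∫ y, ‖zonalFun (cesaroKernel n M) x y‖ ∂(nu n) = cesaroNumber (realDim n) M := by
  have h := integral_zonalFun_cesaroKernel M x
  simp only [zonalFun, integral_complex_ofReal] at h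
  simp only [norm_zonalFun_cesaroKernel]
  exact_mod_cast h

theorem integral_norm_zonalFun_cesaroKernel_mul_cosAngle {M : ℕ} (hM : 1 ≤ M) (x : CSphere n) :
    ∫ y, ‖zonalFun (cesaroKernel n M) x y‖ * cosAngle x y ∂(nu n) =
      cesaroNumber (realDim n) (M - 1) := by
  have h := congrFun (zonalConv_cesaroKernel_of_mem_eigenspace hM (cosAngle_mem_eigenspace x)) x
  rw [Pi.smul_apply, zonalConv_zonal_one_cosAngle, smul_eq_mul, mul_one] at h
  simp only [zonalConv, zonalFun, ← Complex.ofReal_mul, integral_complex_ofReal] at h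
  simp only [norm_zonalFun_cesaroKernel]
  exact_mod_cast h

theorem norm_zonalConv_cesaroKernel_sub_le {φ : CSphere n → ℂ} (hφ : Continuous φ) {ε K : ℝ}
    (hosc : ∀ x y, ‖φ y - φ x‖ ≤ ε + K * dist x y ^ 2) {M : ℕ} (hM : 1 ≤ M) (x : CSphere n) :
    ‖zonalConv (cesaroKernel n M) φ x - cesaroNumber (realDim n) M * φ x‖ ≤
      ε * cesaroNumber (realDim n) M +
        2 * K * (cesaroNumber (realDim n) M - cesaroNumber (realDim n) (M - 1)) := by
  let k := zonalFun (cesaroKernel n M) x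
  have hk : Continuous k := continuous_zonalFun_right _ x
  have hcos : Continuous (cosAngle x) := continuous_cosAngle.comp (Continuous.prodMk_right x)
  calc ‖zonalConv (cesaroKernel n M) φ x - cesaroNumber (realDim n) M * φ x‖
      = ‖∫ y, k y * (φ y - φ x) ∂(nu n)‖ := by
        simp only [mul_sub]
        rw [integral_sub (integrable_of_continuous (f := fun y => k y * φ y) (hk.mul hφ))
          ((integrable_of_continuous hk).mul_const _), integral_mul_const,
          integral_zonalFun_cesaroKernel, zonalConv]
    _ ≤ ∫ y, ‖k y * (φ y - φ x)‖ ∂(nu n) := norm_integral_le_integral_norm _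
    _ ≤ ∫ y, ((ε + 2 * K) * ‖k y‖ - 2 * K * (‖k y‖ * cosAngle x y)) ∂(nu n) := by
        refine integral_mono (integrable_of_continuous (by fun_prop))
          (integrable_of_continuous (by fun_prop)) fun y => ?_
        have hxy := mul_le_mul_of_nonneg_left (hosc x y) (norm_nonneg (k y))
        rw [dist_sq_eq_two_mul_one_sub_cosAngle] at hxy
        rw [norm_mul]
        linarith
    _ = (ε + 2 * K) * cesaroNumber (realDim n) M - 2 * K * cesaroNumber (realDim n) (M - 1) := by
        rw [integral_sub (integrable_of_continuous (by fun_prop))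
          (integrable_of_continuous (by fun_prop)), integral_const_mul, integral_const_mul,
          integral_norm_zonalFun_cesaroKernel, integral_norm_zonalFun_cesaroKernel_mul_cosAngle hM]
    _ = _ := by ring

theorem tendstoUniformly_cesaroMean {φ : CSphere n → ℂ} (hφ : Continuous φ) :
    TendstoUniformly (fun M => cesaroMean M φ) φ atTop := by
  refine Metric.tendstoUniformly_iff.2 fun ε hε => ?_
  obtain ⟨K, hK⟩ := exists_norm_sub_le_add_mul_dist_sq hφ (half_pos hε)
  have hlim : Tendsto (fun M => ε / 2 + 2 * K *
      (1 - (cesaroNumber (realDim n) (M - 1) : ℝ) / cesaroNumber (realDim n) M)) atTop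
      (𝓝 (ε / 2)) := by
    simpa using (((tendsto_cesaroNumber_ratio (realDim n) 1).const_sub 1).const_mul
      (2 * K)).const_add (ε / 2)
  filter_upwards [hlim.eventually_lt_const (half_lt_self hε), eventually_ge_atTop 1] with M hM hM1 x
  have hA : (0 : ℝ) < cesaroNumber (realDim n) M := by exact_mod_cast cesaroNumber_pos _ M
  have hA' : (cesaroNumber (realDim n) M : ℂ) ≠ 0 := by exact_mod_cast hA.ne'
  calc dist (φ x) (cesaroMean M φ x)
      = (cesaroNumber (realDim n) M : ℝ)⁻¹ *
        ‖zonalConv (cesaroKernel n M) φ x - cesaroNumber (realDim n) M * φ x‖ := by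
        rw [dist_comm, dist_eq_norm, ← Complex.norm_natCast, ← norm_inv, ← norm_mul, mul_sub,
          inv_mul_cancel_left₀ hA', cesaroMean, Pi.smul_apply, smul_eq_mul]
    _ ≤ (cesaroNumber (realDim n) M : ℝ)⁻¹ * (ε / 2 * cesaroNumber (realDim n) M +
          2 * K * (cesaroNumber (realDim n) M - cesaroNumber (realDim n) (M - 1))) := by
        gcongr
        exact norm_zonalConv_cesaroKernel_sub_le hφ hK hM1 x
    _ = ε / 2 + 2 * K * (1 - cesaroNumber (realDim n) (M - 1) / cesaroNumber (realDim n) M) := by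
        field_simp
    _ < ε := hM

theorem zonalConv_zonal_of_mem_eigenspace {i : ℕ} {u : CSphere n → ℂ} (hu : u ∈ eigenspace n i) :
    zonalConv (zonal n i) u = u := by
  funext x
  refine tendsto_nhds_unique ?_ ((tendstoUniformly_cesaroMean hu.1.continuous).tendsto_at x)
  have hratio := (tendsto_cesaroNumber_ratio (realDim n) i).ofReal.mul_const
    (zonalConv (zonal n i) u x)
  rw [Complex.ofReal_one, one_mul] at hratio
  refine hratio.congr' ?_
  filter_upwards [eventually_ge_atTop i] with M hM
  rw [cesaroMean, zonalConv_cesaroKernel_of_mem_eigenspace hM hu]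
  simp only [Pi.smul_apply, smul_eq_mul]
  push_cast
  ring

theorem zonalConv_zonal_zonalConv_zonal (i j : ℕ) {f : CSphere n → ℂ} (hf : Integrable f (nu n)) :
    zonalConv (zonal n i) (zonalConv (zonal n j) f) =
      if i = j then zonalConv (zonal n j) f else 0 := by
  have hmem := zonalConv_zonal_mem_eigenspace j hf
  split_ifs with hij
  · rw [hij, zonalConv_zonal_of_mem_eigenspace hmem]
  · exact zonalConv_zonal_eq_zero_of_mem_eigenspace hij hmem

theorem zonalConv_zonal_zonalConv_cesaroKernel (j M : ℕ) {f : CSphere n → ℂ}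
    (hf : Integrable f (nu n)) : zonalConv (zonal n j) (zonalConv (cesaroKernel n M) f) =
      (if j ≤ M then (cesaroNumber (realDim n) (M - j) : ℂ) else 0) • zonalConv (zonal n j) f := by
  rw [zonalConv_cesaroKernel M hf,
    zonalConv_finsetSum _ _ fun i _ => (integrable_zonalConv _ hf).smul _]
  simp only [zonalConv_const_smul, zonalConv_zonal_zonalConv_zonal _ _ hf, smul_ite, smul_zero,
    Finset.sum_ite_eq, Finset.mem_range_succ_iff, ite_smul, zero_smul]

end CesaroMean

section SchurTest

variable {α β 𝕜 E : Type*} [MeasurableSpace α] [MeasurableSpace β] {μ : Measure α} {ν : Measure β}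
  [NormedField 𝕜] [NormedAddCommGroup E] [NormedSpace ℝ E] [NormedSpace 𝕜 E]
  {p A : ℝ≥0∞} {g : β → E}

theorem enorm_integral_smul_le {κ : β → 𝕜} (hκ : StronglyMeasurable κ)
    (hmass : ∫⁻ y, ‖κ y‖ₑ ∂ν ≤ A) (hp : 1 ≤ p) (hg : AEStronglyMeasurable g ν) :
    ‖∫ y, κ y • g y ∂ν‖ₑ ≤
      eLpNorm g p (ν.withDensity fun y => ‖κ y‖ₑ) * A ^ (1 - 1 / p.toReal) := by
  have hexponent : 0 ≤ 1 - 1 / p.toReal := by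
    obtain rfl | hp_top := eq_or_ne p ⊤
    · simp
    · have hp_real : 1 ≤ p.toReal := by simpa using ENNReal.toReal_mono hp_top hp
      exact sub_nonneg.2 (div_le_one_of_le₀ hp_real (by positivity))
  calc ‖∫ y, κ y • g y ∂ν‖ₑ
      ≤ ∫⁻ y, ‖κ y • g y‖ₑ ∂ν := enorm_integral_le_lintegral_enorm _
    _ = ∫⁻ y, ‖g y‖ₑ ∂ν.withDensity fun y => ‖κ y‖ₑ := by
        rw [lintegral_withDensity_eq_lintegral_mul₀ hκ.enorm.aemeasurable hg.enorm]
        simp only [enorm_smul, Pi.mul_apply]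
    _ = eLpNorm g 1 (ν.withDensity fun y => ‖κ y‖ₑ) := eLpNorm_one_eq_lintegral_enorm.symm
    _ ≤ eLpNorm g p (ν.withDensity fun y => ‖κ y‖ₑ) *
          (ν.withDensity fun y => ‖κ y‖ₑ) Set.univ ^ (1 / (1 : ℝ≥0∞).toReal - 1 / p.toReal) :=
        eLpNorm_le_eLpNorm_mul_rpow_measure_univ hp
          (hg.mono_ac (withDensity_absolutelyContinuous _ _))
    _ ≤ _ := by
        rw [withDensity_apply _ MeasurableSet.univ, Measure.restrict_univ, ENNReal.toReal_one,
          div_one]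
        gcongr

theorem enorm_integral_smul_rpow_le {κ : β → 𝕜} (hκ : StronglyMeasurable κ)
    (hmass : ∫⁻ y, ‖κ y‖ₑ ∂ν ≤ A) (hp : 1 ≤ p) (hp_top : p ≠ ⊤) (hg : AEStronglyMeasurable g ν) :
    ‖∫ y, κ y • g y ∂ν‖ₑ ^ p.toReal ≤
      A ^ (p.toReal - 1) * ∫⁻ y, ‖κ y‖ₑ * ‖g y‖ₑ ^ p.toReal ∂ν := by
  have hp0 : p ≠ 0 := (zero_lt_one.trans_le hp).ne'
  have hp_real : 0 < p.toReal := ENNReal.toReal_pos hp0 hp_top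
  refine (ENNReal.rpow_le_rpow (enorm_integral_smul_le hκ hmass hp hg) hp_real.le).trans_eq ?_
  rw [ENNReal.mul_rpow_of_nonneg _ _ hp_real.le, ← ENNReal.rpow_mul,
    eLpNorm_eq_lintegral_rpow_enorm_toReal hp0 hp_top, ← ENNReal.rpow_mul,
    one_div_mul_cancel hp_real.ne', ENNReal.rpow_one, mul_comm,
    sub_mul, one_mul, one_div_mul_cancel hp_real.ne',
    lintegral_withDensity_eq_lintegral_mul₀ hκ.enorm.aemeasurable (hg.enorm.pow_const _)]
  simp only [Pi.mul_apply]

variable {κ : α → β → 𝕜}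

theorem lintegral_enorm_integral_smul_rpow_le [SFinite μ] [SFinite ν]
    (hκ : StronglyMeasurable (Function.uncurry κ)) (hrow : ∀ x, ∫⁻ y, ‖κ x y‖ₑ ∂ν ≤ A)
    (hcol : ∀ y, ∫⁻ x, ‖κ x y‖ₑ ∂μ ≤ A) (hp : 1 ≤ p) (hp_top : p ≠ ⊤)
    (hg : AEStronglyMeasurable g ν) :
    ∫⁻ x, ‖∫ y, κ x y • g y ∂ν‖ₑ ^ p.toReal ∂μ ≤
      A ^ p.toReal * ∫⁻ y, ‖g y‖ₑ ^ p.toReal ∂ν := by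
  have hp_real : 1 ≤ p.toReal := by simpa using ENNReal.toReal_mono hp_top hp
  have hgp : AEMeasurable (fun y => ‖g y‖ₑ ^ p.toReal) ν := hg.enorm.pow_const _
  have hκgp : AEMeasurable (Function.uncurry fun x y => ‖κ x y‖ₑ * ‖g y‖ₑ ^ p.toReal) (μ.prod ν) :=
    hκ.enorm.aemeasurable.mul hgp.comp_snd
  calc ∫⁻ x, ‖∫ y, κ x y • g y ∂ν‖ₑ ^ p.toReal ∂μ
      ≤ ∫⁻ x, A ^ (p.toReal - 1) * ∫⁻ y, ‖κ x y‖ₑ * ‖g y‖ₑ ^ p.toReal ∂ν ∂μ :=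
        lintegral_mono fun x => enorm_integral_smul_rpow_le hκ.of_uncurry_left (hrow x) hp hp_top hg
    _ = A ^ (p.toReal - 1) * ∫⁻ y, ∫⁻ x, ‖κ x y‖ₑ * ‖g y‖ₑ ^ p.toReal ∂μ ∂ν := by
        have hinner : AEMeasurable (fun x => ∫⁻ y, ‖κ x y‖ₑ * ‖g y‖ₑ ^ p.toReal ∂ν) μ :=
          hκgp.lintegral_prod_right'
        rw [lintegral_const_mul'' _ hinner, lintegral_lintegral_swap hκgp]
    _ = A ^ (p.toReal - 1) * ∫⁻ y, (∫⁻ x, ‖κ x y‖ₑ ∂μ) * ‖g y‖ₑ ^ p.toReal ∂ν := by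
        simp only [lintegral_mul_const _ hκ.of_uncurry_right.enorm]
    _ ≤ A ^ (p.toReal - 1) * ∫⁻ y, A * ‖g y‖ₑ ^ p.toReal ∂ν := by
        gcongr with y
        exact hcol y
    _ = A ^ p.toReal * ∫⁻ y, ‖g y‖ₑ ^ p.toReal ∂ν := by
        nth_rewrite 2 [← ENNReal.rpow_one A]
        rw [lintegral_const_mul'' _ hgp, ← mul_assoc,
          ← ENNReal.rpow_add_of_nonneg _ _ (sub_nonneg.2 hp_real) zero_le_one, sub_add_cancel]

theorem eLpNorm_integral_smul_le [SFinite μ] [SFinite ν]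
    (hκ : StronglyMeasurable (Function.uncurry κ)) (hrow : ∀ x, ∫⁻ y, ‖κ x y‖ₑ ∂ν ≤ A)
    (hcol : ∀ y, ∫⁻ x, ‖κ x y‖ₑ ∂μ ≤ A) (hp : 1 ≤ p) (hg : AEStronglyMeasurable g ν) :
    eLpNorm (fun x => ∫ y, κ x y • g y ∂ν) p μ ≤ A * eLpNorm g p ν := by
  obtain rfl | hp_top := eq_or_ne p ⊤
  · simp only [eLpNorm_exponent_top]
    refine eLpNormEssSup_le_of_ae_enorm_bound (.of_forall fun x => ?_)
    refine (enorm_integral_smul_le hκ.of_uncurry_left (hrow x) le_top hg).trans ?_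
    rw [ENNReal.toReal_top, div_zero, sub_zero, ENNReal.rpow_one, mul_comm, eLpNorm_exponent_top]
    gcongr
    exact withDensity_absolutelyContinuous _ _
  · have hp0 : p ≠ 0 := (zero_lt_one.trans_le hp).ne'
    have hp_real : 0 < p.toReal := ENNReal.toReal_pos hp0 hp_top
    have hle := ENNReal.rpow_le_rpow
      (lintegral_enorm_integral_smul_rpow_le (μ := μ) hκ hrow hcol hp hp_top hg)
      (one_div_nonneg.2 hp_real.le)
    rwa [ENNReal.mul_rpow_of_nonneg _ _ (by positivity), ← ENNReal.rpow_mul,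
      mul_one_div_cancel hp_real.ne', ENNReal.rpow_one,
      ← eLpNorm_eq_lintegral_rpow_enorm_toReal hp0 hp_top,
      ← eLpNorm_eq_lintegral_rpow_enorm_toReal hp0 hp_top] at hle

end SchurTest

section LpBound

variable {n : ℕ} [NeZero n] {f : CSphere n → ℂ}

theorem lintegral_enorm_zonalFun_cesaroKernel (M : ℕ) (x : CSphere n) :
    ∫⁻ y, ‖zonalFun (cesaroKernel n M) x y‖ₑ ∂(nu n) = cesaroNumber (realDim n) M := by
  rw [← ofReal_integral_norm_eq_lintegral_enorm
    (integrable_of_continuous (continuous_zonalFun_right _ x)),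
    integral_norm_zonalFun_cesaroKernel, ENNReal.ofReal_natCast]

theorem eLpNorm_zonalConv_cesaroKernel_le (M : ℕ) {p : ℝ≥0∞} (hp : 1 ≤ p)
    (hf : AEStronglyMeasurable f (nu n)) :
    eLpNorm (zonalConv (cesaroKernel n M) f) p (nu n) ≤
      cesaroNumber (realDim n) M * eLpNorm f p (nu n) :=
  eLpNorm_integral_smul_le (κ := zonalFun (cesaroKernel n M))
    (continuous_zonalFun _).stronglyMeasurable
    (fun x => (lintegral_enorm_zonalFun_cesaroKernel M x).le)
    (fun y => by simp only [zonalFun_comm _ _ y, lintegral_enorm_zonalFun_cesaroKernel, le_refl])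
    hp hf

theorem eLpNorm_cesaroMean_le (M : ℕ) {p : ℝ≥0∞} (hp : 1 ≤ p)
    (hf : AEStronglyMeasurable f (nu n)) :
    eLpNorm (cesaroMean M f) p (nu n) ≤ eLpNorm f p (nu n) := by
  have hA : cesaroNumber (realDim n) M ≠ 0 := (cesaroNumber_pos _ _).ne'
  calc eLpNorm (cesaroMean M f) p (nu n)
      = (cesaroNumber (realDim n) M : ℝ≥0∞)⁻¹ *
          eLpNorm (zonalConv (cesaroKernel n M) f) p (nu n) := by
        rw [cesaroMean, eLpNorm_const_smul, enorm_inv (Nat.cast_ne_zero.2 hA), ← ofReal_norm,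
          Complex.norm_natCast, ENNReal.ofReal_natCast]
    _ ≤ (cesaroNumber (realDim n) M : ℝ≥0∞)⁻¹ *
          (cesaroNumber (realDim n) M * eLpNorm f p (nu n)) := by
        gcongr
        exact eLpNorm_zonalConv_cesaroKernel_le M hp hf
    _ = eLpNorm f p (nu n) :=
        ENNReal.inv_mul_cancel_left (Nat.cast_ne_zero.2 hA) (ENNReal.natCast_ne_top _)

theorem exists_eLpNorm_cesaroMean_sub_le_of_continuous {φ : CSphere n → ℂ} (hφ : Continuous φ)
    (p : ℝ≥0∞) {ε : ℝ≥0∞} (hε : 0 < ε) : ∃ M, eLpNorm (cesaroMean M φ - φ) p (nu n) ≤ ε := by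
  obtain ⟨M, hM⟩ := (EMetric.tendstoUniformly_iff.1 (tendstoUniformly_cesaroMean hφ) ε hε).exists
  refine ⟨M, (eLpNorm_le_of_ae_enorm_bound (C := ε) (.of_forall fun x => ?_)).trans_eq (by simp)⟩
  rw [Pi.sub_apply, ← edist_eq_enorm_sub, edist_comm]
  exact (hM x).le

theorem exists_eLpNorm_cesaroMean_sub_le {p : ℝ≥0∞} (hp : 1 ≤ p) (hp_top : p ≠ ⊤)
    (hf : MemLp f p (nu n)) {ε : ℝ≥0∞} (hε : 0 < ε) :
    ∃ M, eLpNorm (cesaroMean M f - f) p (nu n) ≤ ε := by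
  have hε3 : 0 < ε / 3 := ENNReal.div_pos hε.ne' ENNReal.ofNat_ne_top
  obtain ⟨φ, hφ, hφ_mem, hclose⟩ : ∃ φ : CSphere n → ℂ, Continuous φ ∧ MemLp φ p (nu n) ∧
      eLpNorm (f - φ) p (nu n) ≤ ε / 3 := by
    obtain ⟨φ, hclose, hφ_mem⟩ := hf.exists_boundedContinuous_eLpNorm_sub_le hp_top hε3.ne'
    exact ⟨φ, φ.continuous, hφ_mem, hclose⟩
  obtain ⟨M, hM⟩ := exists_eLpNorm_cesaroMean_sub_le_of_continuous hφ p hε3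
  have hmean {u : CSphere n → ℂ} (hu : MemLp u p (nu n)) :
      AEStronglyMeasurable (cesaroMean M u) (nu n) :=
    ((continuous_zonalConv _ (hu.integrable hp)).const_smul _).aestronglyMeasurable
  have hdiff : MemLp (f - φ) p (nu n) := hf.sub hφ_mem
  have hφ_diff : AEStronglyMeasurable (cesaroMean M φ - φ) (nu n) := (hmean hφ_mem).sub hφ_mem.1
  have hsplit : cesaroMean M f - f = cesaroMean M (f - φ) + (cesaroMean M φ - φ) - (f - φ) := by
    simp only [cesaroMean, zonalConv_sub _ (hf.integrable hp) (hφ_mem.integrable hp), smul_sub]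
    abel
  refine ⟨M, ?_⟩
  calc eLpNorm (cesaroMean M f - f) p (nu n)
      ≤ eLpNorm (cesaroMean M (f - φ) + (cesaroMean M φ - φ)) p (nu n) +
          eLpNorm (f - φ) p (nu n) :=
        hsplit ▸ eLpNorm_sub_le ((hmean hdiff).add hφ_diff) hdiff.1 hp
    _ ≤ eLpNorm (cesaroMean M (f - φ)) p (nu n) + eLpNorm (cesaroMean M φ - φ) p (nu n) +
          eLpNorm (f - φ) p (nu n) := by
        gcongr
        exact eLpNorm_add_le (hmean hdiff) hφ_diff hp
    _ ≤ ε / 3 + ε / 3 + ε / 3 := by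
        gcongr
        exact (eLpNorm_cesaroMean_le M hp hdiff.1).trans hclose
    _ = ε := ENNReal.add_thirds ε

theorem ae_eq_zero_of_zonalConv_zonal_eq_zero (hf : Integrable f (nu n))
    (hzero : ∀ j, zonalConv (zonal n j) f = 0) : f =ᵐ[nu n] 0 := by
  rw [← eLpNorm_eq_zero_iff hf.aestronglyMeasurable one_ne_zero, ← nonpos_iff_eq_zero]
  refine le_of_forall_gt_imp_ge_of_dense fun ε hε => ?_
  obtain ⟨M, hM⟩ := exists_eLpNorm_cesaroMean_sub_le le_rfl ENNReal.one_ne_top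
    (memLp_one_iff_integrable.2 hf) hε
  have hmean : cesaroMean M f = 0 := by simp [cesaroMean, zonalConv_cesaroKernel M hf, hzero]
  rwa [hmean, zero_sub, eLpNorm_neg] at hM

theorem ae_eq_sum_zonalConv (hf : Integrable f (nu n)) {K : Finset ℕ}
    (hzero : ∀ j ∉ K, zonalConv (zonal n j) f = 0) :
    f =ᵐ[nu n] ∑ j ∈ K, zonalConv (zonal n j) f := by
  have hcomp (j : ℕ) : Integrable (zonalConv (zonal n j) f) (nu n) := integrable_zonalConv _ hf
  have hsum := integrable_finsetSum' K fun j _ => hcomp j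
  rw [← sub_ae_eq_zero]
  refine ae_eq_zero_of_zonalConv_zonal_eq_zero (hf.sub hsum) fun i => ?_
  rw [zonalConv_sub _ hf hsum, zonalConv_finsetSum _ _ fun j _ => hcomp j]
  simp only [zonalConv_zonal_zonalConv_zonal _ _ hf, Finset.sum_ite_eq]
  split_ifs with hi
  · exact sub_self _
  · rw [hzero i hi, sub_zero]

end LpBound

section Series

open Filter Topology

variable {α E : Type*} [MeasurableSpace α] {μ : Measure α} [NormedAddCommGroup E] [CompleteSpace E]
  {F : ℕ → α → E} {p : ℝ≥0∞}

theorem ae_tendsto_sum_range_tsum (hp : 1 ≤ p) (hF : ∀ i, AEStronglyMeasurable (F i) μ)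
    (hsum : ∑' i, eLpNorm (F i) p μ ≠ ⊤) :
    ∀ᵐ x ∂μ, Tendsto (fun N => (∑ i ∈ Finset.range N, F i) x) atTop (𝓝 (∑' i, F i x)) := by
  filter_upwards [summable_norm_of_tsum_eLpNorm_ne_top hp hF hsum] with x hx
  simpa only [Finset.sum_apply] using hx.of_norm.hasSum.tendsto_sum_nat

theorem eLpNorm_tsum_le (hp : 1 ≤ p) (hF : ∀ i, AEStronglyMeasurable (F i) μ)
    (hsum : ∑' i, eLpNorm (F i) p μ ≠ ⊤) :
    eLpNorm (fun x => ∑' i, F i x) p μ ≤ ∑' i, eLpNorm (F i) p μ := by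
  refine (Lp.eLpNorm_lim_le_liminf_eLpNorm
    (fun N => Finset.aestronglyMeasurable_sum _ fun i _ => hF i) _
    (ae_tendsto_sum_range_tsum hp hF hsum)).trans ?_
  refine liminf_le_of_le (by isBoundedDefault) fun c hc => ?_
  obtain ⟨N, hN⟩ := hc.exists
  exact hN.trans ((eLpNorm_sum_le (fun i _ => hF i) hp).trans (ENNReal.sum_le_tsum _))

theorem memLp_tsum (hp : 1 ≤ p) (hF : ∀ i, AEStronglyMeasurable (F i) μ)
    (hsum : ∑' i, eLpNorm (F i) p μ ≠ ⊤) : MemLp (fun x => ∑' i, F i x) p μ :=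
  ⟨aestronglyMeasurable_of_tendsto_ae _ (fun _ => Finset.aestronglyMeasurable_sum _ fun i _ => hF i)
    (ae_tendsto_sum_range_tsum hp hF hsum), (eLpNorm_tsum_le hp hF hsum).trans_lt hsum.lt_top⟩

end Series

section CesaroSeries

open Polynomial

variable {n : ℕ}

theorem zonalConv_tsum (p : ℝ[X]) {F : ℕ → CSphere n → ℂ}
    (hF : ∀ i, AEStronglyMeasurable (F i) (nu n)) (hsum : ∑' i, eLpNorm (F i) 1 (nu n) ≠ ⊤)
    (x : CSphere n) : zonalConv p (fun y => ∑' i, F i y) x = ∑' i, zonalConv p (F i) x := by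
  obtain ⟨C, hC⟩ := exists_norm_zonalFun_le (n := n) p
  have hbound : ∑' i, ∫⁻ y, ‖zonalFun p x y * F i y‖ₑ ∂(nu n) ≤
      ENNReal.ofReal C * ∑' i, eLpNorm (F i) 1 (nu n) := by
    rw [← ENNReal.tsum_mul_left]
    refine ENNReal.tsum_le_tsum fun i => ?_
    rw [eLpNorm_one_eq_lintegral_enorm, ← lintegral_const_mul' _ _ ENNReal.ofReal_ne_top]
    gcongr with y
    rw [enorm_mul, ← ofReal_norm]
    gcongr
    exact hC x y
  simp only [zonalConv, ← tsum_mul_left]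
  exact integral_tsum (fun i => (continuous_zonalFun_right p x).aestronglyMeasurable.mul (hF i))
    (hbound.trans_lt (ENNReal.mul_lt_top ENNReal.ofReal_lt_top hsum.lt_top)).ne

/-- The superposition of the Cesàro kernels of order `realDim n`, with weights `b`, applied to
`g`. -/
def cesaroSeries (b : ℕ → ℝ) (g : CSphere n → ℂ) (x : CSphere n) : ℂ :=
  ∑' k, ((b k : ℂ) • zonalConv (cesaroKernel n k) g) x

variable {b : ℕ → ℝ} {g : CSphere n → ℂ} {p : ℝ≥0∞}

theorem aestronglyMeasurable_smul_zonalConv (c : ℂ) (q : ℝ[X]) (hg : Integrable g (nu n)) :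
    AEStronglyMeasurable (c • zonalConv q g) (nu n) :=
  ((continuous_zonalConv q hg).const_smul c).aestronglyMeasurable

variable [NeZero n]

theorem tsum_eLpNorm_smul_zonalConv_cesaroKernel_le (hb : 0 ≤ b)
    (hsum : Summable fun k => (cesaroNumber (realDim n) k : ℝ) * b k) (hp : 1 ≤ p)
    (hg : AEStronglyMeasurable g (nu n)) :
    ∑' k, eLpNorm ((b k : ℂ) • zonalConv (cesaroKernel n k) g) p (nu n) ≤
      ENNReal.ofReal (∑' k, (cesaroNumber (realDim n) k : ℝ) * b k) * eLpNorm g p (nu n) := by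
  rw [ENNReal.ofReal_tsum_of_nonneg (fun k => mul_nonneg (Nat.cast_nonneg _) (hb k)) hsum,
    ← ENNReal.tsum_mul_right]
  refine ENNReal.tsum_le_tsum fun k => ?_
  calc eLpNorm ((b k : ℂ) • zonalConv (cesaroKernel n k) g) p (nu n)
      = ENNReal.ofReal (b k) * eLpNorm (zonalConv (cesaroKernel n k) g) p (nu n) := by
        rw [eLpNorm_const_smul, ← ofReal_norm, Complex.norm_real, Real.norm_of_nonneg (hb k)]
    _ ≤ ENNReal.ofReal (b k) * (cesaroNumber (realDim n) k * eLpNorm g p (nu n)) := by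
        gcongr
        exact eLpNorm_zonalConv_cesaroKernel_le k hp hg
    _ = ENNReal.ofReal (cesaroNumber (realDim n) k * b k) * eLpNorm g p (nu n) := by
        rw [ENNReal.ofReal_mul (Nat.cast_nonneg _), ENNReal.ofReal_natCast]
        ring

theorem eLpNorm_cesaroSeries_le (hb : 0 ≤ b)
    (hsum : Summable fun k => (cesaroNumber (realDim n) k : ℝ) * b k) (hp : 1 ≤ p)
    (hg : MemLp g p (nu n)) : eLpNorm (cesaroSeries b g) p (nu n) ≤
      ENNReal.ofReal (∑' k, (cesaroNumber (realDim n) k : ℝ) * b k) * eLpNorm g p (nu n) := by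
  have hle := tsum_eLpNorm_smul_zonalConv_cesaroKernel_le hb hsum hp hg.1
  exact (eLpNorm_tsum_le hp
    (fun k => aestronglyMeasurable_smul_zonalConv _ _ (hg.integrable hp))
    (hle.trans_lt (ENNReal.mul_lt_top ENNReal.ofReal_lt_top hg.2)).ne).trans hle

theorem memLp_cesaroSeries (hb : 0 ≤ b)
    (hsum : Summable fun k => (cesaroNumber (realDim n) k : ℝ) * b k) (hp : 1 ≤ p)
    (hg : MemLp g p (nu n)) : MemLp (cesaroSeries b g) p (nu n) :=
  memLp_tsum hp (fun _ => aestronglyMeasurable_smul_zonalConv _ _ (hg.integrable hp))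
    ((tsum_eLpNorm_smul_zonalConv_cesaroKernel_le hb hsum hp hg.1).trans_lt
      (ENNReal.mul_lt_top ENNReal.ofReal_lt_top hg.2)).ne

theorem zonalConv_zonal_cesaroSeries (hb : 0 ≤ b)
    (hsum : Summable fun k => (cesaroNumber (realDim n) k : ℝ) * b k)
    (hg : Integrable g (nu n)) (j : ℕ) : zonalConv (zonal n j) (cesaroSeries b g) =
      ((∑' i, (cesaroNumber (realDim n) i : ℝ) * b (j + i) : ℝ) : ℂ) • zonalConv (zonal n j) g := by
  have hfin := (tsum_eLpNorm_smul_zonalConv_cesaroKernel_le hb hsum le_rfl hg.1).trans_lt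
    (ENNReal.mul_lt_top ENNReal.ofReal_lt_top (memLp_one_iff_integrable.2 hg).2)
  let weight (k : ℕ) : ℂ := (b k : ℂ) * if j ≤ k then (cesaroNumber (realDim n) (k - j) : ℂ) else 0
  have hsupport : Function.support weight ⊆ Set.range (j + ·) := fun k hk => by
    obtain hjk | hjk := le_or_gt j k
    · exact ⟨k - j, Nat.add_sub_cancel' hjk⟩
    · simp [weight, hjk.not_ge] at hk
  funext x
  calc zonalConv (zonal n j) (cesaroSeries b g) x
      = ∑' k, zonalConv (zonal n j) ((b k : ℂ) • zonalConv (cesaroKernel n k) g) x :=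
        zonalConv_tsum _ (fun k => aestronglyMeasurable_smul_zonalConv _ _ hg) hfin.ne x
    _ = (∑' k, weight k) * zonalConv (zonal n j) g x := by
        simp only [zonalConv_const_smul, zonalConv_zonal_zonalConv_cesaroKernel _ _ hg,
          Pi.smul_apply, smul_eq_mul, ← mul_assoc, tsum_mul_right, weight]
    _ = (∑' i, weight (j + i)) * zonalConv (zonal n j) g x := by
        rw [(add_right_injective j).tsum_eq hsupport]
    _ = _ := by
        simp [weight, mul_comm, Complex.ofReal_tsum]

end CesaroSeries

section Favard

variable {n : ℕ} [NeZero n] {f g : CSphere n → ℂ} {p : ℝ≥0∞} {γ : ℝ}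

theorem IsFracDeriv.zonalConv_zonal_zero_eq_zero (hfg : IsFracDeriv γ f g) :
    zonalConv (zonal n 0) g = 0 := by
  funext x
  rw [← fourierCoeff_zonalFun]
  exact hfg.1 _ (zonalFun_zonal_mem_eigenspace NeZero.one_le 0 x)

theorem IsFracDeriv.zonalConv_zonal (hfg : IsFracDeriv γ f g) {j : ℕ} (hj : 1 ≤ j) :
    zonalConv (zonal n j) g = ((theta n j ^ (γ / 2) : ℝ) : ℂ) • zonalConv (zonal n j) f := by
  funext x
  rw [Pi.smul_apply, smul_eq_mul, ← fourierCoeff_zonalFun, ← fourierCoeff_zonalFun]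
  exact hfg.2 j hj _ (zonalFun_zonal_mem_eigenspace NeZero.one_le j x)

theorem bestApprox_harmonicSpan_le_eLpNorm {K : Finset ℕ} {F : CSphere n → ℂ}
    (hf : Integrable f (nu n)) (hF : Integrable F (nu n))
    (heq : ∀ j ∉ K, zonalConv (zonal n j) f = zonalConv (zonal n j) F) :
    bestApprox f (harmonicSpan n K) p ≤ eLpNorm F p (nu n) := by
  have hdiff : Integrable (f - F) (nu n) := hf.sub hF
  let q := ∑ j ∈ K, zonalConv (zonal n j) (f - F)
  have hq : q ∈ harmonicSpan n K := Submodule.sum_mem _ fun j hj =>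
    le_iSup₂ (f := fun k (_ : k ∈ K) => eigenspace n k) j hj
      (zonalConv_zonal_mem_eigenspace j hdiff)
  have hqF : f - q =ᵐ[nu n] F := by
    have hsum : f - F =ᵐ[nu n] q := ae_eq_sum_zonalConv hdiff fun j hj => by
      rw [zonalConv_sub _ hf hF, heq j hj, sub_self]
    filter_upwards [hsum] with x hx
    rw [Pi.sub_apply, ← hx, Pi.sub_apply, sub_sub_cancel]
  exact (iInf₂_le q hq).trans_eq (eLpNorm_congr_ae hqF)

theorem IsFracDeriv.zonalConv_zonal_eq_smul (hfg : IsFracDeriv γ f g) {j : ℕ} (hj : 1 ≤ j) :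
    zonalConv (zonal n j) f = ((theta n j ^ (-(γ / 2)) : ℝ) : ℂ) • zonalConv (zonal n j) g := by
  rw [hfg.zonalConv_zonal hj, smul_smul, ← Complex.ofReal_mul,
    ← Real.rpow_add (theta_pos NeZero.one_le hj), neg_add_cancel, Real.rpow_zero,
    Complex.ofReal_one, one_smul]

theorem IsFracDeriv.zonalConv_zonal_eq_cesaroSeries {K : Finset ℕ} {N : ℕ} {b : ℕ → ℝ}
    {t : CSphere n → ℂ} (hfg : IsFracDeriv γ f g) (hg : Integrable g (nu n)) (hb : 0 ≤ b)
    (hsum : Summable fun k => (cesaroNumber (realDim n) k : ℝ) * b k)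
    (hmultiplier : ∀ j, N < j →
      HasSum (fun i => (cesaroNumber (realDim n) i : ℝ) * b (j + i)) (theta n j ^ (-(γ / 2))))
    (hK : Finset.Icc 1 N ⊆ K) (h0 : 0 ∉ K → ∫ x, f x ∂(nu n) = 0) (ht : t ∈ harmonicSpan n K)
    {j : ℕ} (hj : j ∉ K) :
    zonalConv (zonal n j) f = zonalConv (zonal n j) (cesaroSeries b (g - t)) := by
  have ht_int : Integrable t (nu n) := integrable_of_continuous (continuous_of_mem_harmonicSpan ht)
  rw [zonalConv_zonal_cesaroSeries hb hsum (hg.sub ht_int), zonalConv_sub _ hg ht_int,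
    zonalConv_zonal_eq_zero_of_mem_harmonicSpan hj ht, sub_zero]
  obtain rfl | hj1 := Nat.eq_zero_or_pos j
  · rw [hfg.zonalConv_zonal_zero_eq_zero, smul_zero]
    exact funext fun x => (zonalConv_zonal_zero f x).trans (h0 hj)
  · have hNj : N < j := by
      by_contra! hjN
      exact hj (hK (Finset.mem_Icc.2 ⟨hj1, hjN⟩))
    rw [(hmultiplier j hNj).tsum_eq, hfg.zonalConv_zonal_eq_smul hj1]

theorem bestApprox_harmonicSpan_le {K : Finset ℕ} {N : ℕ} (hγ : 0 < γ) (hp : 1 ≤ p)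
    (hf : MemLp f p (nu n)) (hg : MemLp g p (nu n)) (hfg : IsFracDeriv γ f g) (hN : 1 ≤ N)
    (hK : Finset.Icc 1 N ⊆ K) (h0 : 0 ∉ K → ∫ x, f x ∂(nu n) = 0) :
    bestApprox f (harmonicSpan n K) p ≤
      ENNReal.ofReal (2 ^ realDim n * 2 ^ γ * (N : ℝ) ^ (-γ)) *
        bestApprox g (harmonicSpan n K) p := by
  obtain ⟨b, hb, hsum, hmass, hmultiplier⟩ :=
    exists_cesaro_weights_theta (n := n) NeZero.one_le hγ (realDim n) hN
  have hC : 0 < 2 ^ realDim n * 2 ^ γ * (N : ℝ) ^ (-γ) := by positivity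
  simp only [bestApprox,
    ENNReal.mul_iInf_of_ne (ENNReal.ofReal_pos.2 hC).ne' ENNReal.ofReal_ne_top]
  refine le_iInf₂ fun t ht => ?_
  have ht_cont : Continuous t := continuous_of_mem_harmonicSpan ht
  have hgt : MemLp (g - t) p (nu n) :=
    hg.sub (ht_cont.memLp_of_hasCompactSupport (HasCompactSupport.of_compactSpace t))
  calc bestApprox f (harmonicSpan n K) p
      ≤ eLpNorm (cesaroSeries b (g - t)) p (nu n) :=
        bestApprox_harmonicSpan_le_eLpNorm (hf.integrable hp)
          ((memLp_cesaroSeries hb hsum hp hgt).integrable hp) fun j hj =>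
            hfg.zonalConv_zonal_eq_cesaroSeries (hg.integrable hp) hb hsum hmultiplier hK h0 ht hj
    _ ≤ _ := (eLpNorm_cesaroSeries_le hb hsum hp hgt).trans (by gcongr)

end Favard

end

end ComplexSphere

open ComplexSphere in
theorem theorem1_general (n : ℕ) (hn : 1 ≤ n) (γ : ℝ) (hγ : 0 < γ) :
    ∃ C : ℝ, 0 < C ∧
      ∀ (p : ℝ≥0∞), 1 ≤ p →
      ∀ (f g : CSphere n → ℂ), MemLp f p (nu n) → MemLp g p (nu n) → IsFracDeriv γ f g →
      ∀ N : ℕ, 1 ≤ N →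
        ((∫ x, f x ∂(nu n) = 0) →
          bestApprox f (polySpace n N) p ≤
            ENNReal.ofReal (C * (N : ℝ) ^ (-γ)) * bestApprox g (polySpace n N) p) ∧
        bestApprox f (polySpaceConst n N) p ≤
          ENNReal.ofReal (C * (N : ℝ) ^ (-γ)) * bestApprox g (polySpaceConst n N) p := by
  have : NeZero n := NeZero.of_pos hn
  refine ⟨2 ^ realDim n * 2 ^ γ, by positivity, fun p hp f g hf hg hfg N hN =>
    ⟨fun hmean => ?_, ?_⟩⟩
  · exact bestApprox_harmonicSpan_le hγ hp hf hg hfg hN subset_rfl fun _ => hmean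
  · exact bestApprox_harmonicSpan_le hγ hp hf hg hfg hN (Finset.Icc_subset_Icc_left zero_le_one)
      fun h0 => absurd (Finset.mem_Icc.2 ⟨le_rfl, N.zero_le⟩) h0

open ComplexSphere in
theorem theorem1 (n : ℕ) (hn : 1 ≤ n) (γ : ℝ) (hγ : ((realDim n : ℝ) - 1) / 2 < γ) :
    ∃ C : ℝ, 0 < C ∧
      ∀ (p : ℝ≥0∞), 1 ≤ p →
      ∀ (f g : CSphere n → ℂ), MemLp f p (nu n) → MemLp g p (nu n) → IsFracDeriv γ f g →
      ∀ N : ℕ, 1 ≤ N →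
        ((∫ x, f x ∂(nu n) = 0) →
          bestApprox f (polySpace n N) p ≤
            ENNReal.ofReal (C * (N : ℝ) ^ (-γ)) * bestApprox g (polySpace n N) p) ∧
        bestApprox f (polySpaceConst n N) p ≤
          ENNReal.ofReal (C * (N : ℝ) ^ (-γ)) * bestApprox g (polySpaceConst n N) p := by
  have hd : (1 : ℝ) ≤ realDim n := by exact_mod_cast (by unfold realDim; lia : 1 ≤ realDim n)
  exact theorem1_general n hn γ (by linarith)
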